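/- **Setting.** Let $Z_j=(X_j,Y_j)\in\mathbb R^m\times\mathbb R^r$, $j=1,\dots,n$, be observed production units: $X_j\ge 0$, $Y_j\ge 0$, $X_j\ne 0$, $Y_j\neq 0$. For a finite set $S$ of units, the BCC production possibility set is $$T(S)=\Big\{(X,Y)\ \Big|\ \sum_{p\in S}\lambda_pX_p\le X,\ \sum_{p\in S}\lambda_pY_p\ge Y,\ \sum_{p\in S}\lambda_p=1,\ \lambda\ge0\Big\}.$$ The input-oriented model for $(X_o,Y_o)$ is: $\min\theta$ subject to $\sum\lambda_pX_p+S^-=\theta X_o$, $\sum\lambda_pY_p-S^+=Y_o$, $\sum\lambda_p=1$, $\lambda,S^-,S^+\ge0$. The output-oriented model is: $\max\eta$ subject to $\sum\lambda_pX_p+S^-=X_o$, $\sum\lambda_pY_p-S^+=\eta Y_o$, with the same remaining constraints. The optimal value is the score, and $(\theta^*X_o,Y_o)$, respectively $(X_o,\eta^*Y_o)$, is the projection of the unit. A point of $T(S)$ is *efficient* if, in both models, optimal solutions exist and each of them has objective value $1$ and zero slacks. (For either model alone this gives the same notion.) A *terminal unit* is an efficient extreme point $z$ of $T(S)$ such that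 some half-line $\{z+td: t\ge 0\}$, $d\neq0$, is a face (an infinite edge). Its *terminal directions* are those among the vectors $(e_k,0)$ and $-(0,e_i)$ for which this half-line is a face. For a coordinate $c$ let $d_c=(e_k,0)$ if $c$ is the $k$-th input and $d_c=-(0,e_i)$ if $c$ is the $i$-th output. **The procedure.** Let $T$ be the production possibility set of the observed units. Fix $\rho\in(0,1)$ and a set $O$ of orientations (input, output, or both). An observed unit that is efficient in $T$ is called originally efficient. "Lost" means that fewer observed units are efficient in the current production possibility set than in $T$. "Moving closer" replaces a distance $\delta>0$ by any $\delta'$ with $0<\delta'\le\rho\delta$. All artificial units have nonnegative, nonzero input and output vectors when they are inserted. *Part 1.* For every observed unit $Z_j$ that is terminal in $T$, every terminal direction $d_c$ of it, and every two-dimensional plane through $Z_j$ spanned by the axes of $c$ and another coordinate $c'\ne c$: insert, outside $T$, a unit $Z_j+\alpha d_c-\delta d_{c'}$ with arbitrary $\alpha,\delta>0$. While an efficient unit is lost in the set spanned by the observed units and this unit, move it closer ($\alpha$ stays fixed and $\delta$ shrinks). Then store it. *Part 2.* Add all stored units. While an efficient unit is lost, move all stored units closer. Then delete the inefficient artificial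 units. *Part 3.* While some observed unit has, for some orientation in $O$, a projection that is not efficient in the current set (which includes the artificial units stored so far): choose such a unit and orientation, and insert, outside the current set, a unit obtained by moving the projection outwards along the radial direction (score $\theta^*-\delta$, respectively $\eta^*+\delta$, with $\delta>0$). While an efficient unit is lost, move this unit closer. Then store it. *Part 4.* While an originally efficient unit is lost, move all units stored in Part 3 simultaneously closer along the radial direction. Output the set $A$ of all artificial units that are efficient. **Theorem.** (a) Whenever the procedure, with any choices allowed above, ends with output $A$, the modified production possibility set $\widetilde T$ spanned by the observed units and $A$ has the following properties: 1. every originally efficient observed unit is efficient in $\widetilde T$; 2. every observed unit that is terminal in $T$ is efficient and not terminal in $\widetilde T$; 3. for every unit (observed or in $A$) that is not efficient in $\widetilde T$ and every orientation in $O$, the projection on the frontier of $\widetilde T$ exists and belongs to a face of $\widetilde T$ all of whose points are efficient. (b) In every execution each of the correction ("while … move closer") loops of Parts 1–4 ends after finitely many steps. (c) If all components of all $X_j$ and $Y_j$ are strictly positive, then from every state that the procedure can reach it can be continued so that it ends. In particular, terminating runs exist. -/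

import Mathlib

noncomputable section

namespace DEA

/-- Points `(X, Y)` of the space of `m` inputs and `r` outputs. -/
abbrev Act (m r : ℕ) : Type := (Fin m → ℝ) × (Fin r → ℝ)

/-- Production units: nonnegative inputs and outputs, neither vector being zero
(so that the radial models below have optimal values). -/
def IsProductionUnit {m r : ℕ} (z : Act m r) : Prop :=
  0 ≤ z.1 ∧ z.1 ≠ 0 ∧ 0 ≤ z.2 ∧ z.2 ≠ 0

/-- The BCC production possibility set spanned by a finite set `S` of units. -/
def pps {m r : ℕ} (S : Finset (Act m r)) : Set (Act m r) :=
  {z | ∃ w : Act m r → ℝ, (∀ p ∈ S, 0 ≤ w p) ∧ ∑ p ∈ S, w p = 1 ∧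
    ∑ p ∈ S, w p • p.1 ≤ z.1 ∧ z.2 ≤ ∑ p ∈ S, w p • p.2}

/-- The two BCC models: input-oriented and output-oriented. -/
inductive Orientation
  | input
  | output

/-- The point `(t X, Y)` (input orientation) or `(X, t Y)` (output orientation). -/
def radial {m r : ℕ} : Orientation → ℝ → Act m r → Act m r
  | .input, t, z => (t • z.1, z.2)
  | .output, t, z => (z.1, t • z.2)

/-- `t` is at least as good an objective value as `t'`: the input model minimizes, the output
model maximizes. -/
def AtLeastAsGood : Orientation → ℝ → ℝ → Prop
  | .input, t, t' => t ≤ t'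
  | .output, t, t' => t' ≤ t

/-- Feasible solutions of the primal BCC model of orientation `o` for the unit `z`: objective
variable `t`, intensities `w`, input slacks `sm`, output slacks `sp`. -/
structure IsFeasible {m r : ℕ} (o : Orientation) (S : Finset (Act m r)) (z : Act m r)
    (t : ℝ) (w : Act m r → ℝ) (sm : Fin m → ℝ) (sp : Fin r → ℝ) : Prop where
  inputs : ∑ p ∈ S, w p • p.1 + sm = (radial o t z).1
  outputs : ∑ p ∈ S, w p • p.2 - sp = (radial o t z).2
  sum_one : ∑ p ∈ S, w p = 1
  intensity_nonneg : ∀ p ∈ S, 0 ≤ w p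
  inputSlack_nonneg : 0 ≤ sm
  outputSlack_nonneg : 0 ≤ sp

def IsOptimal {m r : ℕ} (o : Orientation) (S : Finset (Act m r)) (z : Act m r)
    (t : ℝ) (w : Act m r → ℝ) (sm : Fin m → ℝ) (sp : Fin r → ℝ) : Prop :=
  IsFeasible o S z t w sm sp ∧
    ∀ t' w' sm' sp', IsFeasible o S z t' w' sm' sp' → AtLeastAsGood o t t'

/-- `t` is the optimal value (efficiency score) of `z`; the radial projection of `z` on the
frontier is then `radial o t z`. -/
def IsScore {m r : ℕ} (o : Orientation) (S : Finset (Act m r)) (z : Act m r) (t : ℝ) : Prop :=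
  ∃ w sm sp, IsOptimal o S z t w sm sp

/-- Efficiency with respect to the model of orientation `o`: every optimal solution has
objective value one and no slacks. -/
def IsEfficientFor {m r : ℕ} (o : Orientation) (S : Finset (Act m r)) (z : Act m r) : Prop :=
  z ∈ pps S ∧ (∃ t, IsScore o S z t) ∧
    ∀ t w sm sp, IsOptimal o S z t w sm sp → t = 1 ∧ sm = 0 ∧ sp = 0

/-- Efficiency with respect to the BCC model. (When `S` consists of production units, the two
orientations single out the same points.) -/
def IsEfficient {m r : ℕ} (S : Finset (Act m r)) (z : Act m r) : Prop :=
  ∀ o, IsEfficientFor o S z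

/-- The half-line from `z` in direction `d`. -/
def ray {m r : ℕ} (z d : Act m r) : Set (Act m r) :=
  {p | ∃ t : ℝ, 0 ≤ t ∧ p = z + t • d}

/-- Terminal units: extreme efficient points from which an infinite edge (a face that is a
half-line) goes out. -/
def IsTerminal {m r : ℕ} (S : Finset (Act m r)) (z : Act m r) : Prop :=
  IsEfficient S z ∧ z ∈ (pps S).extremePoints ℝ ∧
    ∃ d : Act m r, d ≠ 0 ∧ IsExposed ℝ (pps S) (ray z d)

/-- The directions `(e_k, 0)` and `(0, -e_i)`. -/
def worse {m r : ℕ} : Fin m ⊕ Fin r → Act m r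
  | .inl k => (Pi.single k 1, 0)
  | .inr i => (0, -Pi.single i 1)

/-- The set of observed units. -/
def observed {m r n : ℕ} (Z : Fin n → Act m r) : Finset (Act m r) :=
  Finset.univ.image Z

/-- The number of observed units that are efficient in the PPS of `S` is less than the original
number. -/
def Lost {m r n : ℕ} (Z : Fin n → Act m r) (S : Finset (Act m r)) : Prop :=
  {j | IsEfficient S (Z j)}.ncard < {j | IsEfficient (observed Z) (Z j)}.ncard

/-- An artificial unit of Part 1. It lies in the two-dimensional plane through the unit `unit`
that is spanned by the axes of the two coordinates `dir` and `other`, at distance `along` in the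
terminal direction of coordinate `dir` and at distance `dist` from the infinite edge, on the
side where coordinate `other` improves. -/
structure Smoothing (m r n : ℕ) where
  unit : Fin n
  dir : Fin m ⊕ Fin r
  other : Fin m ⊕ Fin r
  along : ℝ
  dist : ℝ

def Smoothing.pos {m r n : ℕ} (Z : Fin n → Act m r) (a : Smoothing m r n) : Act m r :=
  Z a.unit + a.along • worse a.dir - a.dist • worse a.other

/-- The triples (terminal unit, terminal direction, two-dimensional section containing it) that
Part 1 runs through. -/
def IsSlot {m r n : ℕ} (Z : Fin n → Act m r) (j : Fin n) (c c' : Fin m ⊕ Fin r) : Prop :=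
  IsTerminal (observed Z) (Z j) ∧ IsExposed ℝ (pps (observed Z)) (ray (Z j) (worse c)) ∧ c' ≠ c

/-- `a'` is `a` moved closer to the frontier: the distance is multiplied by at most `ρ`. -/
def Smoothing.Closer {m r n : ℕ} (ρ : ℝ) (a a' : Smoothing m r n) : Prop :=
  a'.unit = a.unit ∧ a'.dir = a.dir ∧ a'.other = a.other ∧ a'.along = a.along ∧
    0 < a'.dist ∧ a'.dist ≤ ρ * a.dist

/-- An artificial unit of Part 3: the projection (score `base`) of the unit `unit`, moved
outwards along the radial direction by `dist`. -/
structure Pushing (n : ℕ) where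
  unit : Fin n
  orient : Orientation
  base : ℝ
  dist : ℝ

def Pushing.pos {m r n : ℕ} (Z : Fin n → Act m r) (a : Pushing n) : Act m r :=
  match a.orient with
  | .input => radial .input (a.base - a.dist) (Z a.unit)
  | .output => radial .output (a.base + a.dist) (Z a.unit)

def Pushing.Closer {n : ℕ} (ρ : ℝ) (a a' : Pushing n) : Prop :=
  a'.unit = a.unit ∧ a'.orient = a.orient ∧ a'.base = a.base ∧
    0 < a'.dist ∧ a'.dist ≤ ρ * a.dist

/-- Observed units together with stored artificial units of Part 1. -/
def withSmoothings {m r n : ℕ} (Z : Fin n → Act m r) (L : List (Smoothing m r n)) :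
    Finset (Act m r) :=
  observed Z ∪ (L.map (Smoothing.pos Z)).toFinset

/-- Observed units, artificial units `K` left by Part 2, and artificial units of Part 3. -/
def withPushings {m r n : ℕ} (Z : Fin n → Act m r) (K : Finset (Act m r)) (L : List (Pushing n)) :
    Finset (Act m r) :=
  observed Z ∪ K ∪ (L.map (Pushing.pos Z)).toFinset

/-- The observed unit `j` is projected, with score `t`, on a point of the frontier of the PPS of
`S` that is only weakly efficient. -/
def ProjectsWeakly {m r n : ℕ} (Z : Fin n → Act m r) (S : Finset (Act m r)) (o : Orientation)
    (j : Fin n) (t : ℝ) : Prop :=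
  IsScore o S (Z j) t ∧ ¬ IsEfficient S (radial o t (Z j))

open Classical in
/-- The members of `B` that are efficient in the PPS of `S`. -/
def efficientPart {m r : ℕ} (S B : Finset (Act m r)) : Finset (Act m r) :=
  B.filter (fun p => IsEfficient S p)

/-- States of the procedure. In Parts 1 and 3 there is a list of stored artificial units and,
possibly, the artificial unit that is being processed. -/
inductive State (m r n : ℕ)
  | part1 (stored : List (Smoothing m r n)) (current : Option (Smoothing m r n))
  | part2 (stored : List (Smoothing m r n))
  | part3 (kept : Finset (Act m r)) (stored : List (Pushing n)) (current : Option (Pushing n))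
  | part4 (kept : Finset (Act m r)) (stored : List (Pushing n))
  | done (A : Finset (Act m r))

/-- The passes through the bodies of the four correction loops, which move artificial units
closer to the frontier. -/
inductive Correction {m r n : ℕ} (Z : Fin n → Act m r) (ρ : ℝ) : State m r n → State m r n → Prop
  | move1 (L : List (Smoothing m r n)) (a a' : Smoothing m r n)
      (guard : Lost Z (insert (a.pos Z) (observed Z))) (closer : a.Closer ρ a') :
      Correction Z ρ (.part1 L (some a)) (.part1 L (some a'))
  | move2 (L L' : List (Smoothing m r n))
      (guard : Lost Z (withSmoothings Z L)) (closer : List.Forall₂ (Smoothing.Closer ρ) L L') :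
      Correction Z ρ (.part2 L) (.part2 L')
  | move3 (K : Finset (Act m r)) (L : List (Pushing n)) (a a' : Pushing n)
      (guard : Lost Z (withPushings Z K (a :: L))) (closer : a.Closer ρ a') :
      Correction Z ρ (.part3 K L (some a)) (.part3 K L (some a'))
  | move4 (K : Finset (Act m r)) (L L' : List (Pushing n))
      (guard : Lost Z (withPushings Z K L)) (closer : List.Forall₂ (Pushing.Closer ρ) L L') :
      Correction Z ρ (.part4 K L) (.part4 K L')

/-- All other steps of the procedure; `O` is the set of orientations of the models used for
projecting. -/
inductive Progress {m r n : ℕ} (Z : Fin n → Act m r) (O : Set Orientation) :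
    State m r n → State m r n → Prop
  /-- Insert an artificial unit, outside the PPS, in a section not yet treated. -/
  | insert1 (L : List (Smoothing m r n)) (a : Smoothing m r n)
      (slot : IsSlot Z a.unit a.dir a.other)
      (fresh : ∀ b ∈ L, ¬ (b.unit = a.unit ∧ b.dir = a.dir ∧ b.other = a.other))
      (along_pos : 0 < a.along) (dist_pos : 0 < a.dist)
      (isUnit : IsProductionUnit (a.pos Z)) (outside : a.pos Z ∉ pps (observed Z)) :
      Progress Z O (.part1 L none) (.part1 L (some a))
  /-- The first inner loop ends: store the artificial unit. -/
  | store1 (L : List (Smoothing m r n)) (a : Smoothing m r n)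
      (guard : ¬ Lost Z (insert (a.pos Z) (observed Z))) :
      Progress Z O (.part1 L (some a)) (.part1 (a :: L) none)
  /-- Part 1 ends when all sections have been treated. -/
  | end1 (L : List (Smoothing m r n))
      (all : ∀ j c c', IsSlot Z j c c' → ∃ b ∈ L, b.unit = j ∧ b.dir = c ∧ b.other = c') :
      Progress Z O (.part1 L none) (.part2 L)
  /-- Part 2 ends: delete the inefficient artificial units. -/
  | end2 (L : List (Smoothing m r n)) (guard : ¬ Lost Z (withSmoothings Z L)) :
      Progress Z O (.part2 L)
        (.part3 (efficientPart (withSmoothings Z L) (L.map (Smoothing.pos Z)).toFinset) [] none)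
  /-- Take a unit that is projected on a weakly efficient face and insert an artificial unit
  obtained by moving the projection outwards along the radial direction. -/
  | insert3 (K : Finset (Act m r)) (L : List (Pushing n)) (a : Pushing n)
      (orient_mem : a.orient ∈ O)
      (guard : ProjectsWeakly Z (withPushings Z K L) a.orient a.unit a.base)
      (dist_pos : 0 < a.dist) (isUnit : IsProductionUnit (a.pos Z))
      (outside : a.pos Z ∉ pps (withPushings Z K L)) :
      Progress Z O (.part3 K L none) (.part3 K L (some a))
  /-- The inner loop of Part 3 ends: store the artificial unit. -/
  | store3 (K : Finset (Act m r)) (L : List (Pushing n)) (a : Pushing n)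
      (guard : ¬ Lost Z (withPushings Z K (a :: L))) :
      Progress Z O (.part3 K L (some a)) (.part3 K (a :: L) none)
  /-- Part 3 ends when no observed unit is projected on a weakly efficient face. -/
  | end3 (K : Finset (Act m r)) (L : List (Pushing n))
      (guard : ¬ ∃ o ∈ O, ∃ j t, ProjectsWeakly Z (withPushings Z K L) o j t) :
      Progress Z O (.part3 K L none) (.part4 K L)
  /-- Part 4 ends: output all efficient artificial units. -/
  | end4 (K : Finset (Act m r)) (L : List (Pushing n))
      (guard : ¬ Lost Z (withPushings Z K L)) :
      Progress Z O (.part4 K L)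
        (.done (efficientPart (withPushings Z K L) (K ∪ (L.map (Pushing.pos Z)).toFinset)))

/-- One step of the procedure. -/
def Step {m r n : ℕ} (Z : Fin n → Act m r) (O : Set Orientation) (ρ : ℝ)
    (s s' : State m r n) : Prop :=
  Progress Z O s s' ∨ Correction Z ρ s s'

/-- `s` can be reached from `s₀` in finitely many steps. -/
def Reaches {m r n : ℕ} (Z : Fin n → Act m r) (O : Set Orientation) (ρ : ℝ)
    (s₀ s : State m r n) : Prop :=
  Relation.ReflTransGen (Step Z O ρ) s₀ s

/-- The initial state: no artificial units. -/
def start (m r n : ℕ) : State m r n := .part1 [] none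

end DEA

end

/-!
The production possibility set (PPS) of finitely many units is the convex hull of the units plus
the orthant generated by the directions `worse c`. For production units, efficiency in either
radial model means being undominated in the PPS (`isEfficient_iff`), so that it depends on the PPS
only, and a radial line meets the efficient points in the projection or not at all
(`IsPareto.radial_score_eq`).

Everything rests on one fact about polyhedra: an undominated point maximizes over the PPS a
functional that is strictly decreasing in every direction `worse c` (`IsPareto.exists_support`;
the proof separates from a finitely generated cone, which is closed by Carathéodory's theorem).
The maximizers of such a functional form a face of undominated points. Moreover a dominated point
of the PPS lies strictly below the supporting hyperplane of every efficient unit, so new units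
that are close enough to dominated points destroy no efficient unit
(`exists_pos_isPareto_of_near`). The units of Part 1 are displaced from points of infinite edges
other than the endpoint, those of Part 3 from projections that are only weakly efficient; both
kinds of points are dominated. Since every correction shrinks the distances by the factor `ρ`, all
correction loops are finite. The test at the end of the inner loop of Part 3 is the test of Part 4,
so no efficient unit is lost on entering Part 4, and its loop is never executed.

Infinite edges of a PPS point in a direction `worse c`. An infinite edge of the final PPS at an
observed unit would therefore be one of the original PPS, but Part 1 has placed a unit beyond it in
a plane containing it, which the final PPS still contains; so it is not a face
(`not_isTerminal_of_mem_pps`). Deleting inefficient units does not change the PPS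
(`pps_eq_of_isPareto_mem`), and thus the tests that end Parts 3 and 4 give the remaining properties
of the output. The corresponding invariant of the states is `Invariant`.

The procedure can be completed because Part 1 treats finitely many planes, where positivity of the
data leaves room to insert a unit, and because in Part 3 a unit can be inserted so close to the
frontier that all efficient projections stay efficient, while the new unit, which is efficient,
becomes the projection of the unit it was inserted for. Each such insertion reduces the number of
pairs of an orientation and a unit that are still to be treated (`exists_pushing`).
-/

namespace DEA

/-! ### Finitely generated cones are closed -/

section Cone

variable {ι V : Type*} [AddCommGroup V] [Module ℝ V]

/-- The cone generated by the vectors `v i`, `i ∈ s`. -/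
def coneOf (v : ι → V) (s : Finset ι) : Set V :=
  {x | ∃ a : ι → ℝ, (∀ i ∈ s, 0 ≤ a i) ∧ ∑ i ∈ s, a i • v i = x}

lemma coneOf_mono (v : ι → V) {s t : Finset ι} (h : s ⊆ t) : coneOf v s ⊆ coneOf v t := by
  classical
  rintro x ⟨a, ha, rfl⟩
  refine ⟨fun i => if i ∈ s then a i else 0, fun i _ => ?_, ?_⟩
  · dsimp only
    split_ifs with hi
    exacts [ha i hi, le_rfl]
  · rw [← Finset.sum_subset h (fun i _ hi => by simp [hi])]
    exact Finset.sum_congr rfl fun i hi => by simp [hi]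

/-- If the generators are linearly dependent, one of them can be dropped from the representation
of a given point. -/
lemma exists_mem_coneOf_erase [DecidableEq ι] (v : ι → V) {s : Finset ι} {x : V}
    (hx : x ∈ coneOf v s) (hs : ¬ LinearIndepOn ℝ v (s : Set ι)) :
    ∃ i ∈ s, x ∈ coneOf v (s.erase i) := by
  obtain ⟨a, ha, rfl⟩ := hx
  have hdep : ∃ g : ι → ℝ, ∑ i ∈ s, g i • v i = 0 ∧ ∃ i ∈ s, 0 < g i := by
    rw [linearIndepOn_finset_iff] at hs
    push Not at hs
    obtain ⟨g, hg, i, hi, hgi⟩ := hs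
    rcases lt_or_gt_of_ne hgi with h | h
    · exact ⟨fun j => -g j, by simp [hg], i, hi, by simpa using h⟩
    · exact ⟨g, hg, i, hi, h⟩
  obtain ⟨g, hg, i₀, hi₀, hgi₀⟩ := hdep
  -- The multiple of the dependency that can be subtracted is bounded by the smallest ratio.
  obtain ⟨i, hi, hmin⟩ := Finset.exists_min_image (s.filter fun i => 0 < g i)
    (fun i => a i / g i) ⟨i₀, by simp [hi₀, hgi₀]⟩
  obtain ⟨his, hgi⟩ := Finset.mem_filter.1 hi
  refine ⟨i, his, fun j => a j - a i / g i * g j, fun j hj => ?_, ?_⟩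
  · have hjs := Finset.mem_of_mem_erase hj
    have hr : 0 ≤ a i / g i := div_nonneg (ha i his) hgi.le
    rcases lt_or_ge 0 (g j) with h | h
    · have := hmin j (by simp [hjs, h])
      rw [le_div_iff₀ h] at this
      simpa using this
    · have := mul_nonpos_of_nonneg_of_nonpos hr h
      have := ha j hjs
      dsimp only
      linarith
  · have hsum : ∑ j ∈ s, (a j - a i / g i * g j) • v j = ∑ j ∈ s, a j • v j := by
      simp only [sub_smul, Finset.sum_sub_distrib, mul_smul, ← Finset.smul_sum, hg, smul_zero,
        sub_zero]
    rw [← hsum]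
    refine Finset.sum_erase _ ?_
    dsimp only
    rw [div_mul_cancel₀ _ hgi.ne', sub_self, zero_smul]

/-- Carathéodory's theorem for cones. -/
lemma exists_linearIndepOn_mem_coneOf (v : ι → V) (s : Finset ι) {x : V} (hx : x ∈ coneOf v s) :
    ∃ t ⊆ s, LinearIndepOn ℝ v (t : Set ι) ∧ x ∈ coneOf v t := by
  classical
  induction s using Finset.strongInduction with
  | H s ih =>
    by_cases hs : LinearIndepOn ℝ v (s : Set ι)
    · exact ⟨s, subset_rfl, hs, hx⟩
    · obtain ⟨i, hi, hxi⟩ := exists_mem_coneOf_erase v hx hs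
      obtain ⟨t, ht, h⟩ := ih _ (Finset.erase_ssubset hi) hxi
      exact ⟨t, ht.trans (Finset.erase_subset _ _), h⟩

lemma convex_coneOf (v : ι → V) (s : Finset ι) : Convex ℝ (coneOf v s) := by
  rintro _ ⟨a, ha, rfl⟩ _ ⟨b, hb, rfl⟩ p q hp hq _
  refine ⟨fun i => p * a i + q * b i, fun i hi => ?_, ?_⟩
  · have := ha i hi
    have := hb i hi
    positivity
  · simp [add_smul, Finset.sum_add_distrib, mul_smul, Finset.smul_sum]

variable [TopologicalSpace V] [IsTopologicalAddGroup V] [ContinuousSMul ℝ V] [T2Space V]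

lemma isClosed_coneOf_of_linearIndepOn (v : ι → V) (s : Finset ι)
    (hs : LinearIndepOn ℝ v (s : Set ι)) : IsClosed (coneOf v s) := by
  classical
  have hker : LinearMap.ker (Fintype.linearCombination ℝ (fun i : s => v i)) = ⊥ := by
    exact LinearMap.ker_eq_bot.2 (linearIndependent_iff_injective_fintypeLinearCombination.1 hs)
  have hcl := (LinearMap.isClosedEmbedding_of_injective hker).isClosedMap _
    (isClosed_Ici (a := (0 : s → ℝ)))
  convert hcl using 1
  ext x
  constructor
  · rintro ⟨a, ha, rfl⟩
    refine ⟨fun i => a i, fun i => ha i i.2, ?_⟩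
    rw [Fintype.linearCombination_apply]
    exact Finset.sum_coe_sort s fun i => a i • v i
  · rintro ⟨a, ha, rfl⟩
    refine ⟨fun i => if h : i ∈ s then a ⟨i, h⟩ else 0, fun i hi => ?_, ?_⟩
    · simpa [hi] using ha ⟨i, hi⟩
    · rw [Fintype.linearCombination_apply,
        ← Finset.sum_coe_sort s fun i => (if h : i ∈ s then a ⟨i, h⟩ else 0) • v i]
      simp

lemma isClosed_coneOf (v : ι → V) (s : Finset ι) : IsClosed (coneOf v s) := by
  classical
  have : coneOf v s = ⋃ t ∈ s.powerset.filter fun t : Finset ι => LinearIndepOn ℝ v (t : Set ι),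
      coneOf v t := by
    ext x
    simp only [Finset.mem_filter, Finset.mem_powerset, Set.mem_iUnion, exists_prop]
    constructor
    · intro hx
      obtain ⟨t, ht, hli, hxt⟩ := exists_linearIndepOn_mem_coneOf v s hx
      exact ⟨t, ⟨ht, hli⟩, hxt⟩
    · rintro ⟨t, ⟨ht, _⟩, hxt⟩
      exact coneOf_mono v ht hxt
  rw [this]
  refine isClosed_biUnion_finset fun t ht => ?_
  exact isClosed_coneOf_of_linearIndepOn v t (Finset.mem_filter.1 ht).2

/-- A point outside a finitely generated cone is separated from it by a linear functional. -/
lemma exists_separating_of_notMem_coneOf [LocallyConvexSpace ℝ V] (v : ι → V) (s : Finset ι)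
    {x : V} (hx : x ∉ coneOf v s) :
    ∃ l : StrongDual ℝ V, (∀ i ∈ s, l (v i) ≤ 0) ∧ 0 < l x := by
  classical
  obtain ⟨l, u, hu, hux⟩ :=
    geometric_hahn_banach_closed_point (convex_coneOf v s) (isClosed_coneOf v s) hx
  have h0 : 0 < u := by simpa using hu 0 ⟨0, by simp, by simp⟩
  refine ⟨l, fun i hi => ?_, h0.trans hux⟩
  by_contra! hpos
  have := hu ((u / l (v i)) • v i)
    ⟨Pi.single i (u / l (v i)), fun j _ => by
      by_cases hj : j = i
      · subst hj; simp; positivity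
      · simp [hj], by
      rw [Finset.sum_eq_single_of_mem i hi fun j _ hj => by simp [hj]]; simp⟩
  rw [map_smul, smul_eq_mul, div_mul_cancel₀ _ hpos.ne'] at this
  exact lt_irrefl _ this

end Cone

/-! ### The domination order and production possibility sets -/

variable {m r : ℕ}

/-- The coordinate in direction `worse c`: an input, or the negative of an output. -/
def cost : Fin m ⊕ Fin r → Act m r →ₗ[ℝ] ℝ
  | .inl k => LinearMap.proj k ∘ₗ LinearMap.fst ℝ _ _
  | .inr i => -(LinearMap.proj i ∘ₗ LinearMap.snd ℝ _ _)

@[simp] lemma cost_inl (k : Fin m) (z : Act m r) : cost (.inl k) z = z.1 k := rfl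

@[simp] lemma cost_inr (i : Fin r) (z : Act m r) : cost (.inr i) z = -z.2 i := rfl

lemma cost_worse (c c' : Fin m ⊕ Fin r) : cost c (worse c') = if c = c' then 1 else 0 := by
  rcases c with k | i <;> rcases c' with k' | i' <;> simp [worse, Pi.single_apply]

@[simp] lemma cost_worse_self (c : Fin m ⊕ Fin r) : cost c (worse c) = 1 := by
  simp [cost_worse]

lemma cost_worse_of_ne {c c' : Fin m ⊕ Fin r} (h : c ≠ c') : cost c (worse c') = 0 := by
  simp [cost_worse, h]

lemma cost_ext {p q : Act m r} (h : ∀ c, cost c p = cost c q) : p = q := by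
  refine Prod.ext (funext fun k => h (.inl k)) (funext fun i => ?_)
  simpa using h (.inr i)

lemma sum_cost_smul_worse (z : Act m r) : ∑ c, cost c z • worse c = z := by
  refine cost_ext fun c => ?_
  simp only [map_sum, map_smul, cost_worse, smul_eq_mul, mul_ite, mul_one, mul_zero]
  simp only [Finset.sum_ite_eq, Finset.mem_univ, if_true]

lemma map_eq_sum_cost (l : Act m r →ₗ[ℝ] ℝ) (z : Act m r) :
    l z = ∑ c, cost c z * l (worse c) := by
  conv_lhs => rw [← sum_cost_smul_worse z]
  simp

lemma continuous_cost (c : Fin m ⊕ Fin r) : Continuous (cost c) :=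
  LinearMap.continuous_of_finiteDimensional _

/-- `p` uses at most the inputs of `q` and produces at least its outputs. -/
def Dominates (p q : Act m r) : Prop := ∀ c, cost c p ≤ cost c q

lemma dominates_iff {p q : Act m r} : Dominates p q ↔ p.1 ≤ q.1 ∧ q.2 ≤ p.2 := by
  simp [Dominates, Sum.forall, Pi.le_def]

lemma Dominates.refl (p : Act m r) : Dominates p p := fun _ => le_rfl

lemma Dominates.trans {p q s : Act m r} (h : Dominates p q) (h' : Dominates q s) :
    Dominates p s := fun c => (h c).trans (h' c)

lemma Dominates.antisymm {p q : Act m r} (h : Dominates p q) (h' : Dominates q p) : p = q :=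
  cost_ext fun c => (h c).antisymm (h' c)

lemma mem_pps_iff {S : Finset (Act m r)} {z : Act m r} :
    z ∈ pps S ↔ ∃ u ∈ convexHull ℝ (S : Set (Act m r)), Dominates u z := by
  simp only [Finset.mem_convexHull', dominates_iff]
  constructor
  · rintro ⟨w, h0, h1, hx, hy⟩
    refine ⟨_, ⟨w, h0, h1, rfl⟩, ?_, ?_⟩
    · simpa [Prod.fst_sum] using hx
    · simpa [Prod.snd_sum] using hy
  · rintro ⟨_, ⟨w, h0, h1, rfl⟩, hx, hy⟩
    exact ⟨w, h0, h1, by simpa [Prod.fst_sum] using hx, by simpa [Prod.snd_sum] using hy⟩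

lemma convexHull_subset_pps (S : Finset (Act m r)) :
    convexHull ℝ (S : Set (Act m r)) ⊆ pps S :=
  fun u hu => mem_pps_iff.2 ⟨u, hu, .refl u⟩

lemma mem_pps_of_mem {S : Finset (Act m r)} {z : Act m r} (hz : z ∈ S) : z ∈ pps S :=
  convexHull_subset_pps S (subset_convexHull ℝ _ hz)

lemma mem_pps_of_dominates {S : Finset (Act m r)} {p q : Act m r} (hp : p ∈ pps S)
    (h : Dominates p q) : q ∈ pps S := by
  obtain ⟨u, hu, hup⟩ := mem_pps_iff.1 hp
  exact mem_pps_iff.2 ⟨u, hu, hup.trans h⟩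

lemma add_smul_worse_mem_pps {S : Finset (Act m r)} {p : Act m r} (hp : p ∈ pps S) {t : ℝ}
    (ht : 0 ≤ t) (c : Fin m ⊕ Fin r) : p + t • worse c ∈ pps S := by
  refine mem_pps_of_dominates hp fun c' => ?_
  simp only [map_add, map_smul, cost_worse, smul_eq_mul]
  split_ifs <;> simp [ht]

lemma convex_pps (S : Finset (Act m r)) : Convex ℝ (pps S) := by
  intro p hp q hq a b ha hb hab
  obtain ⟨u, hu, hup⟩ := mem_pps_iff.1 hp
  obtain ⟨v, hv, hvq⟩ := mem_pps_iff.1 hq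
  refine mem_pps_iff.2 ⟨a • u + b • v, convex_convexHull ℝ _ hu hv ha hb hab, fun c => ?_⟩
  simp only [map_add, map_smul, smul_eq_mul]
  have := mul_le_mul_of_nonneg_left (hup c) ha
  have := mul_le_mul_of_nonneg_left (hvq c) hb
  linarith

lemma pps_subset_of_subset_pps {S T : Finset (Act m r)} (h : ∀ p ∈ S, p ∈ pps T) :
    pps S ⊆ pps T := by
  intro z hz
  obtain ⟨u, hu, huz⟩ := mem_pps_iff.1 hz
  exact mem_pps_of_dominates (convexHull_min h (convex_pps T) hu) huz

lemma pps_mono {S T : Finset (Act m r)} (h : S ⊆ T) : pps S ⊆ pps T :=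
  pps_subset_of_subset_pps fun _ hp => mem_pps_of_mem (h hp)

lemma map_le_of_mem_pps {S : Finset (Act m r)} {l : Act m r →ₗ[ℝ] ℝ} {b : ℝ}
    (hl : ∀ c, l (worse c) ≤ 0) (hb : ∀ p ∈ S, l p ≤ b) {z : Act m r} (hz : z ∈ pps S) :
    l z ≤ b := by
  obtain ⟨u, hu, huz⟩ := mem_pps_iff.1 hz
  have hub : l u ≤ b := convexHull_min (t := {x | l x ≤ b}) hb
    (convex_halfSpace_le l.isLinear b) hu
  have : l z - l u ≤ 0 := by
    rw [← map_sub, map_eq_sum_cost]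
    refine Finset.sum_nonpos fun c _ => mul_nonpos_of_nonneg_of_nonpos ?_ (hl c)
    simpa using huz c
  linarith

lemma exists_le_cost (S : Finset (Act m r)) (c : Fin m ⊕ Fin r) :
    ∃ b, ∀ z ∈ pps S, b ≤ cost c z := by
  refine ⟨-∑ p ∈ S, |cost c p|, fun z hz => ?_⟩
  have := map_le_of_mem_pps (S := S) (l := -cost c) (b := ∑ p ∈ S, |cost c p|)
    (fun c' => by simp only [LinearMap.neg_apply, cost_worse]; split_ifs <;> simp)
    (fun p hp => (neg_le_abs _).trans
      (Finset.single_le_sum (f := fun p => |cost c p|) (fun _ _ => abs_nonneg _) hp)) hz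
  rw [LinearMap.neg_apply] at this
  linarith

lemma isClosed_pps (S : Finset (Act m r)) : IsClosed (pps S) := by
  have h1 : IsCompact (convexHull ℝ (S : Set (Act m r))) := S.finite_toSet.isCompact_convexHull ℝ
  have h2 : IsClosed {d : Act m r | ∀ c, 0 ≤ cost c d} := by
    simp only [Set.ofPred_forall]
    exact isClosed_iInter fun c => isClosed_le continuous_const (continuous_cost c)
  convert h2.add_left_of_isCompact h1 using 1
  ext z
  simp only [mem_pps_iff, Set.mem_add]
  constructor
  · rintro ⟨u, hu, huz⟩
    exact ⟨u, hu, z - u, fun c => by simpa using huz c, by simp⟩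
  · rintro ⟨u, hu, d, hd, rfl⟩
    exact ⟨u, hu, fun c => by simpa using hd c⟩

/-! ### Pareto points and their supporting functionals -/

/-- A point of the PPS that no other point of the PPS dominates. -/
def IsPareto (S : Finset (Act m r)) (z : Act m r) : Prop :=
  z ∈ pps S ∧ ∀ z' ∈ pps S, Dominates z' z → z' = z

lemma isPareto_congr {S T : Finset (Act m r)} (h : pps S = pps T) {z : Act m r} :
    IsPareto S z ↔ IsPareto T z := by
  simp only [IsPareto, h]

lemma IsPareto.of_pps_subset {S T : Finset (Act m r)} {z : Act m r} (hz : IsPareto T z)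
    (h : pps S ⊆ pps T) (hS : z ∈ pps S) : IsPareto S z :=
  ⟨hS, fun z' hz' => hz.2 z' (h hz')⟩

lemma IsPareto.mem_convexHull {S : Finset (Act m r)} {z : Act m r} (hz : IsPareto S z) :
    z ∈ convexHull ℝ (S : Set (Act m r)) := by
  obtain ⟨u, hu, huz⟩ := mem_pps_iff.1 hz.1
  rwa [← hz.2 u (convexHull_subset_pps S hu) huz]

/-- A functional with positive prices: it decreases in every direction `worse c`. -/
def IsPrice (l : StrongDual ℝ (Act m r)) : Prop := ∀ c, l (worse c) < 0

/-- For a single coordinate `c`, a supporting functional at a Pareto point with a nonzero price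
of `c`. -/
lemma IsPareto.exists_support_coord {S : Finset (Act m r)} {z : Act m r} (hz : IsPareto S z)
    (c : Fin m ⊕ Fin r) :
    ∃ l : StrongDual ℝ (Act m r), (∀ c', l (worse c') ≤ 0) ∧ l (worse c) < 0 ∧
      ∀ p ∈ S, l p ≤ l z := by
  classical
  set v : Act m r ⊕ (Fin m ⊕ Fin r) → Act m r := Sum.elim (fun p => p - z) worse
  have hnot : -worse c ∉ coneOf v (S.disjSum Finset.univ) := by
    rintro ⟨a, ha, hsum⟩
    rw [Finset.sum_disjSum] at hsum
    have haS : ∀ p ∈ S, 0 ≤ a (.inl p) := fun p hp => ha _ (by simpa using hp)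
    have hac : ∀ c', 0 ≤ a (.inr c') := fun c' => ha _ (by simp)
    simp only [v, Sum.elim_inl, Sum.elim_inr] at hsum
    have hcost : ∀ c', cost c' (∑ p ∈ S, a (.inl p) • (p - z)) + a (.inr c') =
        -cost c' (worse c) := by
      intro c'
      have h := congrArg (cost c') hsum
      have h2 : cost c' (∑ c, a (.inr c) • worse c) = a (.inr c') := by
        simp only [map_sum, map_smul, cost_worse, smul_eq_mul, mul_ite, mul_one, mul_zero]
        simp only [Finset.sum_ite_eq, Finset.mem_univ, if_true]
      rwa [map_add, h2, map_neg] at h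
    rcases (Finset.sum_nonneg haS).eq_or_lt with h0 | hpos
    · have h0' := (Finset.sum_eq_zero_iff_of_nonneg haS).1 h0.symm
      have h := hcost c
      rw [Finset.sum_eq_zero fun p hp => by simp [h0' p hp]] at h
      have := hac c
      simp at h
      linarith
    · set A := ∑ p ∈ S, a (.inl p)
      set u := ∑ p ∈ S, (A⁻¹ * a (.inl p)) • p
      have hu : u ∈ pps S := convexHull_subset_pps S <| Finset.mem_convexHull'.2
        ⟨_, fun p hp => mul_nonneg (inv_nonneg.2 hpos.le) (haS p hp), by
          rw [← Finset.mul_sum, inv_mul_cancel₀ hpos.ne'], rfl⟩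
      have hsub : ∑ p ∈ S, a (.inl p) • (p - z) = A • (u - z) := by
        simp only [smul_sub, Finset.sum_sub_distrib, ← Finset.sum_smul, u, Finset.smul_sum,
          ← mul_smul, mul_inv_cancel_left₀ hpos.ne', A]
      have hle : ∀ c', A * (cost c' u - cost c' z) ≤ -cost c' (worse c) := by
        intro c'
        have h := hcost c'
        rw [hsub, map_smul, map_sub, smul_eq_mul] at h
        linarith [hac c']
      have hdom : Dominates u z := by
        intro c'
        have h := hle c'
        have h1 : 0 ≤ cost c' (worse c) := by rw [cost_worse]; split_ifs <;> simp
        by_contra! h2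
        have := mul_pos hpos (sub_pos.2 h2)
        linarith
      have h := hle c
      rw [hz.2 u hu hdom] at h
      simp at h
      linarith
  obtain ⟨l, hl, hlc⟩ := exists_separating_of_notMem_coneOf v _ hnot
  refine ⟨l, fun c' => hl (.inr c') (by simp), by simpa using hlc, fun p hp => ?_⟩
  have := hl (.inl p) (by simpa using hp)
  simpa [v] using this

/-- Pareto points of a polyhedral PPS maximize a functional with positive prices. -/
lemma IsPareto.exists_support {S : Finset (Act m r)} {z : Act m r} (hz : IsPareto S z) :
    ∃ l : StrongDual ℝ (Act m r), IsPrice l ∧ ∀ p ∈ S, l p ≤ l z := by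
  choose l hl0 hl1 hl2 using hz.exists_support_coord
  refine ⟨∑ c, l c, fun c => ?_, fun p hp => ?_⟩
  · rw [sum_apply]
    exact Finset.sum_neg' (fun c' _ => hl0 c' c) ⟨c, Finset.mem_univ c, hl1 c⟩
  · rw [sum_apply, sum_apply]
    exact Finset.sum_le_sum fun c _ => hl2 c p hp

lemma IsPrice.map_le {l : StrongDual ℝ (Act m r)} (hl : IsPrice l) {S : Finset (Act m r)} {b : ℝ}
    (hb : ∀ p ∈ S, l p ≤ b) {z : Act m r} (hz : z ∈ pps S) : l z ≤ b :=
  map_le_of_mem_pps (l := l.toLinearMap) (fun c => (hl c).le) hb hz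

lemma IsPrice.eq_of_dominates {l : StrongDual ℝ (Act m r)} (hl : IsPrice l) {p q : Act m r}
    (h : Dominates p q) (hle : l p ≤ l q) : p = q := by
  have hterm : ∀ c ∈ Finset.univ, cost c (q - p) * l (worse c) ≤ 0 := fun c _ =>
    mul_nonpos_of_nonneg_of_nonpos (by simpa using h c) (hl c).le
  have hsum : 0 ≤ ∑ c, cost c (q - p) * l (worse c) := by
    have h := map_eq_sum_cost l.toLinearMap (q - p)
    simp only [ContinuousLinearMap.coe_coe] at h
    rw [← h, map_sub]
    linarith
  have h0 := (Finset.sum_eq_zero_iff_of_nonpos hterm).1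
    ((Finset.sum_nonpos hterm).antisymm hsum)
  refine cost_ext fun c => ?_
  have := (mul_eq_zero.1 (h0 c (Finset.mem_univ c))).resolve_right (hl c).ne
  rw [map_sub] at this
  linarith

lemma IsPrice.isPareto {l : StrongDual ℝ (Act m r)} (hl : IsPrice l) {S : Finset (Act m r)}
    {z : Act m r} (hz : z ∈ pps S) (hmax : ∀ p ∈ S, l p ≤ l z) : IsPareto S z :=
  ⟨hz, fun _ hz' hdom => hl.eq_of_dominates hdom (hl.map_le hmax hz')⟩

/-- A point of the PPS that is not Pareto lies strictly below every supporting hyperplane with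
positive prices. -/
lemma IsPrice.lt_of_not_isPareto {l : StrongDual ℝ (Act m r)} (hl : IsPrice l)
    {S : Finset (Act m r)} {b : ℝ} (hmax : ∀ p ∈ S, l p ≤ b) {p : Act m r} (hp : p ∈ pps S)
    (hnp : ¬ IsPareto S p) : l p < b := by
  refine (hl.map_le hmax hp).lt_of_ne fun h => hnp ?_
  subst h
  exact hl.isPareto hp hmax

/-- Every Pareto point lies on an exposed face that consists of Pareto points. -/
lemma IsPareto.exists_face {S : Finset (Act m r)} {z : Act m r} (hz : IsPareto S z) :
    ∃ F : Set (Act m r), IsExposed ℝ (pps S) F ∧ (∀ q ∈ F, IsPareto S q) ∧ z ∈ F := by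
  obtain ⟨l, hl, hmax⟩ := hz.exists_support
  refine ⟨{x ∈ pps S | ∀ y ∈ pps S, l y ≤ l x}, fun _ => ⟨l, rfl⟩, fun q hq => ?_,
    hz.1, fun y hy => hl.map_le hmax hy⟩
  exact hl.isPareto hq.1 fun p hp => hq.2 p (mem_pps_of_mem hp)

/-- Pareto points survive if units are added in small distances `δ` from points that lie in the
PPS but are not Pareto. -/
lemma exists_pos_isPareto_of_near {S : Finset (Act m r)} {Q : Set (Act m r)} (hQ : Q.Finite)
    (hQS : ∀ q ∈ Q, IsPareto S q) {P : Set (Act m r × Act m r)} (hP : P.Finite)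
    (hPS : ∀ x ∈ P, x.1 ∈ pps S ∧ ¬ IsPareto S x.1) :
    ∃ ε > 0, ∀ T : Finset (Act m r),
      (∀ t ∈ T, t ∈ S ∨ ∃ x ∈ P, ∃ δ : ℝ, 0 < δ ∧ δ ≤ ε ∧ t = x.1 + δ • x.2) →
      ∀ q ∈ Q, q ∈ pps T → IsPareto T q := by
  have key : ∀ q ∈ Q, ∀ᶠ ε in nhdsWithin (0 : ℝ) (Set.Ioi 0), ∀ T : Finset (Act m r),
      (∀ t ∈ T, t ∈ S ∨ ∃ x ∈ P, ∃ δ : ℝ, 0 < δ ∧ δ ≤ ε ∧ t = x.1 + δ • x.2) →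
      q ∈ pps T → IsPareto T q := by
    intro q hq
    obtain ⟨l, hl, hmax⟩ := (hQS q hq).exists_support
    have hx : ∀ x ∈ P, ∀ᶠ ε in nhdsWithin (0 : ℝ) (Set.Ioi 0),
        ∀ δ : ℝ, 0 < δ → δ ≤ ε → l (x.1 + δ • x.2) ≤ l q := by
      intro x hxP
      have hlt := hl.lt_of_not_isPareto hmax (hPS x hxP).1 (hPS x hxP).2
      have hev : ∀ᶠ ε in nhdsWithin (0 : ℝ) (Set.Ioi 0), l x.1 + ε * |l x.2| < l q := by
        have hc : Filter.Tendsto (fun ε : ℝ => l x.1 + ε * |l x.2|)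
            (nhdsWithin 0 (Set.Ioi 0)) (nhds (l x.1)) := by
          have : Continuous fun ε : ℝ => l x.1 + ε * |l x.2| := by fun_prop
          simpa using (this.tendsto 0).mono_left nhdsWithin_le_nhds
        exact hc.eventually_lt_const hlt
      filter_upwards [hev] with ε hε δ hδ hδε
      rw [map_add, map_smul, smul_eq_mul]
      have h1 := mul_le_mul_of_nonneg_left (le_abs_self (l x.2)) hδ.le
      have h2 := mul_le_mul_of_nonneg_right hδε (abs_nonneg (l x.2))
      linarith
    filter_upwards [(Filter.eventually_all_finite hP).2 hx] with ε hε T hT hqT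
    refine hl.isPareto hqT fun t ht => ?_
    rcases hT t ht with h | ⟨x, hxP, δ, hδ, hδε, rfl⟩
    · exact hmax t h
    · exact hε x hxP δ hδ hδε
  have hpos : ∀ᶠ ε in nhdsWithin (0 : ℝ) (Set.Ioi 0), 0 < ε := eventually_mem_nhdsWithin
  obtain ⟨ε, hε, hε0⟩ := (((Filter.eventually_all_finite hQ).2 key).and hpos).exists
  exact ⟨ε, hε0, fun T hT q hq => hε q hq T hT⟩

/-- A unit added outside the PPS is Pareto in the enlarged PPS. -/
lemma isPareto_insert_of_notMem [DecidableEq (Act m r)] {S : Finset (Act m r)} {q : Act m r}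
    (hq : q ∉ pps S) : IsPareto (insert q S) q := by
  refine ⟨mem_pps_of_mem (Finset.mem_insert_self q S), fun z' hz' hdom => ?_⟩
  obtain ⟨u, hu, huz⟩ := mem_pps_iff.1 hz'
  suffices u = q by subst this; exact hdom.antisymm huz
  rw [Finset.coe_insert] at hu
  rcases S.eq_empty_or_nonempty with rfl | hne
  · simpa using hu
  · rw [convexHull_insert (by exact_mod_cast hne)] at hu
    simp only [mem_convexJoin, Set.mem_singleton_iff, exists_eq_left] at hu
    obtain ⟨v, hv, a, b, ha, hb, hab, rfl⟩ := hu
    rcases hb.eq_or_lt with rfl | hb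
    · have : a = 1 := by linarith
      simp [this]
    · refine absurd (mem_pps_iff.2 ⟨v, hv, fun c => ?_⟩) hq
      have h := huz.trans hdom c
      simp only [map_add, map_smul, smul_eq_mul] at h
      refine le_of_mul_le_mul_left ?_ hb
      have : a = 1 - b := by linarith
      subst this
      linarith

/-- The Pareto units span the whole PPS. -/
lemma pps_eq_of_isPareto_mem {S T : Finset (Act m r)} (hT : T ⊆ S)
    (h : ∀ p ∈ S, IsPareto S p → p ∈ T) : pps T = pps S := by
  classical
  refine (pps_mono hT).antisymm ?_
  -- Units are dropped one by one, each being dominated by the PPS of the others.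
  induction hn : (S \ T).card generalizing S with
  | zero =>
    have hST : S ⊆ T := by
      rwa [Finset.card_eq_zero, Finset.sdiff_eq_empty_iff_subset] at hn
    exact pps_mono hST
  | succ k ih =>
    obtain ⟨p, hp⟩ : (S \ T).Nonempty := by
      rw [← Finset.card_pos, hn]; omega
    obtain ⟨hpS, hpT⟩ := Finset.mem_sdiff.1 hp
    have hmem : p ∈ pps (S.erase p) := by
      by_contra hnot
      have := isPareto_insert_of_notMem hnot
      rw [Finset.insert_erase hpS] at this
      exact hpT (h p hpS this)
    have hsub : pps S ⊆ pps (S.erase p) := pps_subset_of_subset_pps fun q hq => by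
      by_cases hqp : q = p
      · exact hqp ▸ hmem
      · exact mem_pps_of_mem (Finset.mem_erase.2 ⟨hqp, hq⟩)
    have heq : pps (S.erase p) = pps S := (pps_mono (Finset.erase_subset p S)).antisymm hsub
    refine hsub.trans (ih (S := S.erase p) ?_ ?_ ?_)
    · exact fun q hq => Finset.mem_erase.2 ⟨fun h => hpT (h ▸ hq), hT hq⟩
    · exact fun q hq hqP => h q (Finset.mem_of_mem_erase hq) ((isPareto_congr heq).1 hqP)
    · rw [Finset.erase_sdiff_comm, Finset.card_erase_of_mem hp, hn]; rfl

/-! ### Production units and radial movements -/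

lemma isProductionUnit_iff {z : Act m r} : IsProductionUnit z ↔ 0 < z.1 ∧ 0 < z.2 := by
  simp only [IsProductionUnit, lt_iff_le_and_ne, ne_eq, eq_comm, and_assoc]

lemma convex_isProductionUnit : Convex ℝ {z : Act m r | IsProductionUnit z} := by
  intro p hp q hq a b ha hb hab
  simp only [Set.mem_ofPred_eq, isProductionUnit_iff] at hp hq ⊢
  rcases ha.eq_or_lt with rfl | ha
  · obtain rfl : b = 1 := by linarith
    simpa using hq
  · exact ⟨add_pos_of_pos_of_nonneg (smul_pos ha hp.1) (smul_nonneg hb hq.1.le),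
      add_pos_of_pos_of_nonneg (smul_pos ha hp.2) (smul_nonneg hb hq.2.le)⟩

lemma IsPareto.isProductionUnit {S : Finset (Act m r)} (hS : ∀ p ∈ S, IsProductionUnit p)
    {z : Act m r} (hz : IsPareto S z) : IsProductionUnit z :=
  convexHull_min hS convex_isProductionUnit hz.mem_convexHull

@[simp] lemma radial_one (o : Orientation) (z : Act m r) : radial o 1 z = z := by
  cases o <;> simp [radial]

lemma radial_dominates {z : Act m r} (hz : IsProductionUnit z) {o : Orientation} {t t' : ℝ}
    (h : AtLeastAsGood o t t') : Dominates (radial o t z) (radial o t' z) := by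
  rw [dominates_iff]
  cases o
  · exact ⟨smul_le_smul_of_nonneg_right h hz.1, le_rfl⟩
  · exact ⟨le_rfl, smul_le_smul_of_nonneg_right h hz.2.2.1⟩

lemma radial_injective {z : Act m r} (hz : IsProductionUnit z) {o : Orientation} {t t' : ℝ}
    (h : radial o t z = radial o t' z) : t = t' := by
  cases o
  · exact smul_left_injective ℝ hz.2.1 (congrArg Prod.fst h)
  · exact smul_left_injective ℝ hz.2.2.2 (congrArg Prod.snd h)

lemma atLeastAsGood_total (o : Orientation) (t t' : ℝ) :
    AtLeastAsGood o t t' ∨ AtLeastAsGood o t' t := by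
  cases o
  · exact le_total t t'
  · exact le_total t' t

lemma AtLeastAsGood.antisymm {o : Orientation} {t t' : ℝ} (h : AtLeastAsGood o t t')
    (h' : AtLeastAsGood o t' t) : t = t' := by
  cases o
  · exact le_antisymm h h'
  · exact le_antisymm h' h

/-! ### Efficiency and scores in terms of the production possibility set -/

lemma IsFeasible.radial_mem {o : Orientation} {S : Finset (Act m r)} {z : Act m r} {t : ℝ}
    {w : Act m r → ℝ} {sm : Fin m → ℝ} {sp : Fin r → ℝ} (h : IsFeasible o S z t w sm sp) :
    radial o t z ∈ pps S := by
  refine ⟨w, h.intensity_nonneg, h.sum_one, ?_, ?_⟩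
  · rw [← h.inputs]
    exact le_add_of_nonneg_right h.inputSlack_nonneg
  · rw [← h.outputs]
    exact sub_le_self _ h.outputSlack_nonneg

lemma exists_isFeasible {o : Orientation} {S : Finset (Act m r)} {z : Act m r} {t : ℝ}
    (h : radial o t z ∈ pps S) : ∃ w sm sp, IsFeasible o S z t w sm sp := by
  obtain ⟨w, h0, h1, hx, hy⟩ := h
  exact ⟨w, _, _, by rw [add_sub_cancel], by rw [sub_sub_cancel], h1, h0, sub_nonneg.2 hx,
    sub_nonneg.2 hy⟩

lemma isOptimal_iff {o : Orientation} {S : Finset (Act m r)} {z : Act m r} {t : ℝ}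
    {w : Act m r → ℝ} {sm : Fin m → ℝ} {sp : Fin r → ℝ} :
    IsOptimal o S z t w sm sp ↔ IsFeasible o S z t w sm sp ∧
      ∀ t', radial o t' z ∈ pps S → AtLeastAsGood o t t' := by
  refine and_congr_right fun _ => ⟨fun h t' ht' => ?_, fun h t' w' sm' sp' hf => ?_⟩
  · obtain ⟨w', sm', sp', hf⟩ := exists_isFeasible ht'
    exact h t' w' sm' sp' hf
  · exact h t' hf.radial_mem

lemma isScore_iff {o : Orientation} {S : Finset (Act m r)} {z : Act m r} {t : ℝ} :
    IsScore o S z t ↔ radial o t z ∈ pps S ∧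
      ∀ t', radial o t' z ∈ pps S → AtLeastAsGood o t t' := by
  simp only [IsScore, isOptimal_iff]
  constructor
  · rintro ⟨w, sm, sp, hf, h⟩
    exact ⟨hf.radial_mem, h⟩
  · rintro ⟨hm, h⟩
    obtain ⟨w, sm, sp, hf⟩ := exists_isFeasible hm
    exact ⟨w, sm, sp, hf, h⟩

lemma isScore_congr {S T : Finset (Act m r)} (h : pps S = pps T) {o : Orientation}
    {z : Act m r} {t : ℝ} : IsScore o S z t ↔ IsScore o T z t := by
  simp only [isScore_iff, h]

lemma IsEfficientFor.isPareto {o : Orientation} {S : Finset (Act m r)} {z : Act m r}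
    (h : IsEfficientFor o S z) : IsPareto S z := by
  obtain ⟨hz, ⟨t, w, sm, sp, ht⟩, hall⟩ := h
  obtain ⟨rfl, -, -⟩ := hall t w sm sp ht
  refine ⟨hz, fun z' hz' hdom => ?_⟩
  obtain ⟨u, hu, huz'⟩ := mem_pps_iff.1 hz'
  obtain ⟨v, h0, h1, rfl⟩ := Finset.mem_convexHull'.1 hu
  obtain ⟨hx, hy⟩ := dominates_iff.1 (huz'.trans hdom)
  -- The slacks with respect to the convex combination below `z'` belong to an optimal solution.
  obtain ⟨-, hsm, hsp⟩ := hall 1 v (z.1 - (∑ p ∈ S, v p • p).1) ((∑ p ∈ S, v p • p).2 - z.2)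
    ⟨⟨by rw [radial_one, Prod.fst_sum]; exact add_sub_cancel _ _,
      by rw [radial_one, Prod.snd_sum]; exact sub_sub_cancel _ _, h1, h0,
      sub_nonneg.2 hx, sub_nonneg.2 hy⟩, ht.2⟩
  have heq : ∑ p ∈ S, v p • p = z :=
    Prod.ext (sub_eq_zero.1 hsm).symm (sub_eq_zero.1 hsp)
  exact hdom.antisymm (heq ▸ huz')

lemma IsPareto.isScore_one {S : Finset (Act m r)} {z : Act m r} (hz : IsPareto S z)
    (hzu : IsProductionUnit z) (o : Orientation) : IsScore o S z 1 := by
  refine isScore_iff.2 ⟨by simpa using hz.1, fun t ht => ?_⟩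
  rcases atLeastAsGood_total o 1 t with h | h
  · exact h
  · have := hz.2 _ ht (by simpa using radial_dominates hzu h)
    have : t = 1 := radial_injective hzu (this.trans (radial_one o z).symm)
    rwa [this] at h ⊢

lemma IsPareto.isEfficient {S : Finset (Act m r)} {z : Act m r} (hz : IsPareto S z)
    (hzu : IsProductionUnit z) : IsEfficient S z := by
  intro o
  refine ⟨hz.1, ⟨1, hz.isScore_one hzu o⟩, fun t w sm sp ht => ?_⟩
  obtain ⟨hf, hopt⟩ := isOptimal_iff.1 ht
  obtain rfl : t = 1 := (hopt 1 (by simpa using hz.1)).antisymm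
    ((isScore_iff.1 (hz.isScore_one hzu o)).2 t hf.radial_mem)
  have hx := hf.inputs
  have hy := hf.outputs
  rw [radial_one] at hx hy
  set u : Act m r := ∑ p ∈ S, w p • p with hu
  have hu1 : ∑ p ∈ S, w p • p.1 = u.1 := by simp [hu, Prod.fst_sum]
  have hu2 : ∑ p ∈ S, w p • p.2 = u.2 := by simp [hu, Prod.snd_sum]
  rw [hu1] at hx
  rw [hu2] at hy
  have hmem : u ∈ pps S := convexHull_subset_pps S
    (Finset.mem_convexHull'.2 ⟨w, hf.intensity_nonneg, hf.sum_one, rfl⟩)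
  have huz : u = z := hz.2 u hmem <| dominates_iff.2
    ⟨hx ▸ le_add_of_nonneg_right hf.inputSlack_nonneg, hy ▸ sub_le_self _ hf.outputSlack_nonneg⟩
  rw [huz] at hx hy
  exact ⟨rfl, by simpa using hx, by simpa using hy⟩

/-- For production units, both models single out the Pareto points. -/
lemma isEfficient_iff {S : Finset (Act m r)} {z : Act m r} (hz : IsProductionUnit z) :
    IsEfficient S z ↔ IsPareto S z :=
  ⟨fun h => (h .input).isPareto, fun h => h.isEfficient hz⟩

lemma IsEfficient.isPareto {S : Finset (Act m r)} {z : Act m r} (h : IsEfficient S z) :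
    IsPareto S z := (h .input).isPareto

/-- Units of the PPS have an optimal value in both models: the feasible objective values form a
closed set that is bounded on the side of improvement. -/
lemma exists_isScore {S : Finset (Act m r)} {z : Act m r} (hz : IsProductionUnit z)
    (hzS : z ∈ pps S) (o : Orientation) : ∃ t, IsScore o S z t := by
  simp only [isScore_iff]
  have hne : {t | radial o t z ∈ pps S}.Nonempty := ⟨1, by simpa using hzS⟩
  cases o
  · have hcl : IsClosed {t | radial .input t z ∈ pps S} :=
      (isClosed_pps S).preimage (by simp only [radial]; fun_prop)
    obtain ⟨k, hk⟩ := (Pi.lt_def.1 (isProductionUnit_iff.1 hz).1).2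
    obtain ⟨b, hb⟩ := exists_le_cost S (.inl k)
    have hbd : BddBelow {t | radial .input t z ∈ pps S} := by
      refine ⟨b / z.1 k, fun t ht => ?_⟩
      rw [div_le_iff₀ hk]
      simpa [radial] using hb _ ht
    exact ⟨_, hcl.csInf_mem hne hbd, fun t ht => csInf_le hbd ht⟩
  · have hcl : IsClosed {t | radial .output t z ∈ pps S} :=
      (isClosed_pps S).preimage (by simp only [radial]; fun_prop)
    obtain ⟨i, hi⟩ := (Pi.lt_def.1 (isProductionUnit_iff.1 hz).2).2
    obtain ⟨b, hb⟩ := exists_le_cost S (.inr i)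
    have hbd : BddAbove {t | radial .output t z ∈ pps S} := by
      refine ⟨-b / z.2 i, fun t ht => ?_⟩
      rw [le_div_iff₀ hi]
      have := hb _ ht
      simp [radial] at this
      linarith
    exact ⟨_, hcl.csSup_mem hne hbd, fun t ht => le_csSup hbd ht⟩

/-- If some point on the radial line of `z` is Pareto, it is the projection of `z`. -/
lemma IsPareto.radial_score_eq {S : Finset (Act m r)} {z : Act m r} (hz : IsProductionUnit z)
    {o : Orientation} {t s : ℝ} (ht : IsPareto S (radial o t z)) (hs : IsScore o S z s) :
    radial o s z = radial o t z := by
  rw [isScore_iff] at hs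
  exact ht.2 _ hs.1 (radial_dominates hz (hs.2 t ht.1))

/-- Scores of the input model are positive. -/
lemma pos_of_radial_input_mem {S : Finset (Act m r)} (hS : ∀ p ∈ S, IsProductionUnit p)
    {z : Act m r} (hz : IsProductionUnit z) {t : ℝ} (ht : radial .input t z ∈ pps S) : 0 < t := by
  obtain ⟨u, hu, huz⟩ := mem_pps_iff.1 ht
  have hu' : IsProductionUnit u := convexHull_min hS convex_isProductionUnit hu
  by_contra! h
  have h1 : u.1 ≤ t • z.1 := (dominates_iff.1 huz).1
  have h2 : t • z.1 ≤ 0 := smul_nonpos_of_nonpos_of_nonneg h hz.1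
  exact absurd ((isProductionUnit_iff.1 hu').1.trans_le (h1.trans h2)) (lt_irrefl _)

lemma mem_efficientPart {S B : Finset (Act m r)} {p : Act m r} :
    p ∈ efficientPart S B ↔ p ∈ B ∧ IsEfficient S p := by
  simp [efficientPart]

lemma efficientPart_subset (S B : Finset (Act m r)) : efficientPart S B ⊆ B :=
  fun _ hp => (mem_efficientPart.1 hp).1

/-- Removing artificial units that are not efficient does not change the PPS. -/
lemma pps_union_efficientPart [DecidableEq (Act m r)] {S B : Finset (Act m r)}
    (h : ∀ p ∈ S ∪ B, IsProductionUnit p) :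
    pps (S ∪ efficientPart (S ∪ B) B) = pps (S ∪ B) := by
  refine pps_eq_of_isPareto_mem
    (Finset.union_subset_union subset_rfl (efficientPart_subset _ _)) fun p hp hpar => ?_
  rcases Finset.mem_union.1 hp with h1 | h1
  · exact Finset.mem_union_left _ h1
  · exact Finset.mem_union_right _ (mem_efficientPart.2 ⟨h1, hpar.isEfficient (h p hp)⟩)

/-! ### Infinite edges -/

lemma mem_ray_self (z d : Act m r) : z ∈ ray z d := ⟨0, le_rfl, by simp⟩

lemma ray_smul {z d : Act m r} {t : ℝ} (ht : 0 < t) : ray z (t • d) = ray z d := by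
  ext p
  constructor
  · rintro ⟨s, hs, rfl⟩
    exact ⟨s * t, by positivity, by rw [mul_smul]⟩
  · rintro ⟨s, hs, rfl⟩
    exact ⟨s / t, by positivity, by rw [← mul_smul, div_mul_cancel₀ _ ht.ne']⟩

lemma exists_eq_smul_of_add_mem_ray {z d e : Act m r} (h : z + e ∈ ray z d) :
    ∃ t : ℝ, 0 ≤ t ∧ e = t • d := by
  obtain ⟨t, ht, h⟩ := h
  exact ⟨t, ht, add_left_cancel h⟩

lemma map_worse_nonpos {S : Finset (Act m r)} {l : Act m r →ₗ[ℝ] ℝ} {z : Act m r}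
    (hz : z ∈ pps S) (hmax : ∀ y ∈ pps S, l y ≤ l z) (c : Fin m ⊕ Fin r) : l (worse c) ≤ 0 := by
  simpa using hmax _ (add_smul_worse_mem_pps hz zero_le_one c)

/-- If the PPS contains a point on the improving side of an edge in direction `worse c`, in the
plane of the coordinates `c` and `c'`, then the edge is not a face. -/
lemma notMem_pps_of_isExposed_ray {S : Finset (Act m r)} {z : Act m r} {c c' : Fin m ⊕ Fin r}
    (h : IsExposed ℝ (pps S) (ray z (worse c))) (hc : c' ≠ c) (a : ℝ) {δ : ℝ} (hδ : 0 < δ) :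
    z + a • worse c - δ • worse c' ∉ pps S := by
  intro hmem
  obtain ⟨l, hl⟩ := h ⟨z, mem_ray_self _ _⟩
  have hz : z ∈ pps S ∧ ∀ y ∈ pps S, l y ≤ l z := by
    have := mem_ray_self z (worse c)
    rwa [hl] at this
  have hzc : z + worse c ∈ {x ∈ pps S | ∀ y ∈ pps S, l y ≤ l x} := by
    rw [← hl]
    exact ⟨1, zero_le_one, by simp⟩
  have hlc : l (worse c) = 0 := by
    have h1 := hz.2 _ hzc.1
    have h2 := hzc.2 _ hz.1
    rw [map_add] at h1 h2
    linarith
  have hlc' : l (worse c') = 0 := by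
    have h1 : l (worse c') ≤ 0 := map_worse_nonpos (l := l.toLinearMap) hz.1 hz.2 c'
    have h2 := hz.2 _ hmem
    simp only [map_sub, map_add, map_smul, hlc, smul_eq_mul] at h2
    have h3 : 0 ≤ δ * l (worse c') := by linarith
    exact h1.antisymm (nonneg_of_mul_nonneg_right h3 hδ)
  have hray : z + worse c' ∈ ray z (worse c) := by
    rw [hl]
    refine ⟨by simpa using add_smul_worse_mem_pps hz.1 zero_le_one c', fun y hy => ?_⟩
    rw [map_add, hlc', add_zero]
    exact hz.2 y hy
  obtain ⟨t, -, ht⟩ := exists_eq_smul_of_add_mem_ray hray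
  have := congrArg (cost c') ht
  simp [cost_worse_of_ne hc] at this

/-- Every infinite edge points in a coordinate direction, as the recession cone of the PPS is the
orthant generated by these directions. -/
lemma exists_isExposed_ray_worse {S : Finset (Act m r)} {z d : Act m r} (hd : d ≠ 0)
    (h : IsExposed ℝ (pps S) (ray z d)) : ∃ c, ray z d = ray z (worse c) := by
  obtain ⟨l, hl⟩ := h ⟨z, mem_ray_self _ _⟩
  have hmem : ∀ t : ℝ, 0 ≤ t → z + t • d ∈ {x ∈ pps S | ∀ y ∈ pps S, l y ≤ l x} := by
    intro t ht
    rw [← hl]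
    exact ⟨t, ht, rfl⟩
  have hz : z ∈ pps S ∧ ∀ y ∈ pps S, l y ≤ l z := by simpa using hmem 0 le_rfl
  have hcost : ∀ c, 0 ≤ cost c d := by
    intro c
    obtain ⟨b, hb⟩ := exists_le_cost S c
    by_contra! hneg
    have hbz := hb z hz.1
    -- Far out on the ray the coordinate would drop below its lower bound `b`.
    have ht : 0 ≤ (cost c z - b + 1) / (-cost c d) :=
      div_nonneg (by linarith) (by linarith)
    have h1 := hb _ (hmem _ ht).1
    rw [map_add, map_smul, smul_eq_mul, div_mul_eq_mul_div, mul_div_assoc, div_neg,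
      div_self hneg.ne] at h1
    linarith
  have hld : l d = 0 := by
    have h1 := hz.2 _ (hmem 1 zero_le_one).1
    have h2 := (hmem 1 zero_le_one).2 _ hz.1
    simp only [one_smul, map_add] at h1 h2
    linarith
  obtain ⟨c, hc⟩ : ∃ c, cost c d ≠ 0 := by
    by_contra! h0
    exact hd (cost_ext fun c => by simp [h0 c])
  have hneg : ∀ c, l (worse c) ≤ 0 := map_worse_nonpos (l := l.toLinearMap) hz.1 hz.2
  have hlc : l (worse c) = 0 := by
    have hsum := map_eq_sum_cost l.toLinearMap d
    simp only [ContinuousLinearMap.coe_coe] at hsum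
    have := (Finset.sum_eq_zero_iff_of_nonpos fun c _ =>
      mul_nonpos_of_nonneg_of_nonpos (hcost c) (hneg c)).1 (hsum.symm.trans hld) c
        (Finset.mem_univ c)
    exact (mul_eq_zero.1 this).resolve_left hc
  have hray : z + worse c ∈ ray z d := by
    rw [hl]
    refine ⟨by simpa using add_smul_worse_mem_pps hz.1 zero_le_one c, fun y hy => ?_⟩
    rw [map_add, hlc, add_zero]
    exact hz.2 y hy
  obtain ⟨t, ht, heq⟩ := exists_eq_smul_of_add_mem_ray hray
  have ht0 : 0 < t := by
    refine ht.lt_of_ne ?_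
    rintro rfl
    have := congrArg (cost c) heq
    simp at this
  exact ⟨c, by rw [heq, ray_smul ht0]⟩

lemma isExposed_of_pps_subset {S T : Finset (Act m r)} {F : Set (Act m r)} (h : pps S ⊆ pps T)
    (hF : IsExposed ℝ (pps T) F) (hFS : F ⊆ pps S) (hne : F.Nonempty) :
    IsExposed ℝ (pps S) F := by
  intro _
  obtain ⟨l, hl⟩ := hF hne
  refine ⟨l, Set.ext fun x => ⟨fun hx => ?_, fun hx => ?_⟩⟩
  · have hx' := hx
    rw [hl] at hx'
    exact ⟨hFS hx, fun y hy => hx'.2 y (h hy)⟩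
  · obtain ⟨p, hp⟩ := hne
    have hp' := hp
    rw [hl] at hp' ⊢
    exact ⟨h hx.1, fun y hy => (hp'.2 y hy).trans (hx.2 p (hFS hp))⟩

/-- A unit stops being terminal in a larger PPS if, in every plane that contains one of its
infinite edges, the larger PPS contains a point beyond that edge. -/
lemma not_isTerminal_of_mem_pps {S T : Finset (Act m r)} (h : pps S ⊆ pps T) {z : Act m r}
    (hzu : IsProductionUnit z) (hz : z ∈ pps S)
    (hcov : ∀ c c', IsExposed ℝ (pps S) (ray z (worse c)) → c' ≠ c →
      ∃ a δ : ℝ, 0 < δ ∧ z + a • worse c - δ • worse c' ∈ pps T) : ¬ IsTerminal T z := by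
  rintro ⟨-, -, d, hd, hexp⟩
  obtain ⟨c, hc⟩ := exists_isExposed_ray_worse hd hexp
  rw [hc] at hexp
  have hS : IsExposed ℝ (pps S) (ray z (worse c)) := by
    refine isExposed_of_pps_subset h hexp ?_ ⟨z, mem_ray_self _ _⟩
    rintro _ ⟨t, ht, rfl⟩
    exact add_smul_worse_mem_pps hz ht c
  obtain ⟨k, -⟩ := (Pi.lt_def.1 (isProductionUnit_iff.1 hzu).1).2
  obtain ⟨i, -⟩ := (Pi.lt_def.1 (isProductionUnit_iff.1 hzu).2).2
  obtain ⟨c', hc'⟩ : ∃ c', c' ≠ c := by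
    cases c
    exacts [⟨.inr i, by simp⟩, ⟨.inl k, by simp⟩]
  obtain ⟨a, δ, hδ, hmem⟩ := hcov c c' hS hc'
  exact notMem_pps_of_isExposed_ray hexp hc' a hδ hmem

variable {n : ℕ}

/-! ### Loss of efficient units -/

lemma mem_observed (Z : Fin n → Act m r) (j : Fin n) : Z j ∈ observed Z :=
  Finset.mem_image_of_mem Z (Finset.mem_univ j)

lemma isProductionUnit_of_mem_observed {Z : Fin n → Act m r}
    (hZ : ∀ j, IsProductionUnit (Z j)) {p : Act m r} (hp : p ∈ observed Z) :
    IsProductionUnit p := by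
  obtain ⟨j, -, rfl⟩ := Finset.mem_image.1 hp
  exact hZ j

lemma not_lost_iff {Z : Fin n → Act m r} (hZ : ∀ j, IsProductionUnit (Z j))
    {S : Finset (Act m r)} (hS : observed Z ⊆ S) :
    ¬ Lost Z S ↔ ∀ j, IsPareto (observed Z) (Z j) → IsPareto S (Z j) := by
  simp only [Lost, not_lt, isEfficient_iff (hZ _)]
  have hsub : {j | IsPareto S (Z j)} ⊆ {j | IsPareto (observed Z) (Z j)} := fun j hj =>
    hj.of_pps_subset (pps_mono hS) (mem_pps_of_mem (mem_observed Z j))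
  refine ⟨fun h j hj => ?_, fun h => Set.ncard_le_ncard h⟩
  have heq := Set.eq_of_subset_of_ncard_le hsub h
  exact heq.symm.subset hj

/-- Originally efficient units survive if units are added in small distances `δ` from points that
lie in the PPS but are not Pareto. -/
lemma exists_pos_not_lost_of_near {Z : Fin n → Act m r} (hZ : ∀ j, IsProductionUnit (Z j))
    {S : Finset (Act m r)} (hS : observed Z ⊆ S) (hSl : ¬ Lost Z S)
    {P : Set (Act m r × Act m r)} (hP : P.Finite)
    (hPS : ∀ x ∈ P, x.1 ∈ pps S ∧ ¬ IsPareto S x.1) :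
    ∃ ε > 0, ∀ T : Finset (Act m r), observed Z ⊆ T →
      (∀ t ∈ T, t ∈ S ∨ ∃ x ∈ P, ∃ δ : ℝ, 0 < δ ∧ δ ≤ ε ∧ t = x.1 + δ • x.2) →
      ¬ Lost Z T := by
  obtain ⟨ε, hε, h⟩ := exists_pos_isPareto_of_near (S := S)
    (Q := {q | IsPareto S q ∧ q ∈ Set.range Z})
    ((Set.finite_range Z).subset fun q hq => hq.2) (fun q hq => hq.1) hP hPS
  refine ⟨ε, hε, fun T hT hnear => (not_lost_iff hZ hT).2 fun j hj => ?_⟩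
  exact h T hnear _ ⟨(not_lost_iff hZ hS).1 hSl j hj, j, rfl⟩
    (mem_pps_of_mem (hT (mem_observed Z j)))

/-! ### Artificial units of Part 1 -/

/-- The point of the infinite edge from which an artificial unit of Part 1 is displaced. -/
def Smoothing.edgePoint (Z : Fin n → Act m r) (a : Smoothing m r n) : Act m r :=
  Z a.unit + a.along • worse a.dir

lemma Smoothing.pos_eq (Z : Fin n → Act m r) (a : Smoothing m r n) :
    a.pos Z = a.edgePoint Z + a.dist • (-worse a.other) := by
  rw [smul_neg, ← sub_eq_add_neg]
  rfl

/-- The properties that every artificial unit of Part 1 has from its insertion to the end of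
Part 2. -/
structure Smoothing.IsValid (Z : Fin n → Act m r) (a : Smoothing m r n) : Prop where
  slot : IsSlot Z a.unit a.dir a.other
  along_pos : 0 < a.along
  dist_pos : 0 < a.dist
  isUnit : IsProductionUnit (a.pos Z)

lemma Smoothing.IsValid.edgePoint_mem {Z : Fin n → Act m r} {a : Smoothing m r n}
    (ha : a.IsValid Z) : a.edgePoint Z ∈ pps (observed Z) :=
  add_smul_worse_mem_pps (mem_pps_of_mem (mem_observed Z _)) ha.along_pos.le _

lemma Smoothing.IsValid.not_isPareto_edgePoint {Z : Fin n → Act m r} {a : Smoothing m r n}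
    (ha : a.IsValid Z) : ¬ IsPareto (observed Z) (a.edgePoint Z) := by
  intro h
  have heq := h.2 (Z a.unit) (mem_pps_of_mem (mem_observed Z _)) fun c => by
    simp only [edgePoint, map_add, map_smul, cost_worse, smul_eq_mul]
    have := ha.along_pos.le
    split_ifs <;> simp [this]
  have := congrArg (cost a.dir) heq
  simp [edgePoint] at this
  exact ha.along_pos.ne' this

lemma Smoothing.IsValid.edgePoint_nonneg {Z : Fin n → Act m r}
    (hZ : ∀ j, IsProductionUnit (Z j)) {a : Smoothing m r n} (ha : a.IsValid Z) :
    0 ≤ a.edgePoint Z := by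
  have hpos := ha.isUnit
  have hne := ha.slot.2.2
  have hα := ha.along_pos
  rcases a with ⟨j, c, c', α, δ⟩
  dsimp only at *
  rcases c with k | i
  · have h1 : (0 : Fin m → ℝ) ≤ Pi.single k 1 := Pi.single_nonneg.2 zero_le_one
    refine ⟨?_, ?_⟩
    · simpa [edgePoint, worse] using add_nonneg (hZ j).1 (smul_nonneg hα.le h1)
    · simpa [edgePoint, worse] using (hZ j).2.2.1
  · refine ⟨by simpa [edgePoint, worse] using (hZ j).1, fun i' => ?_⟩
    rcases eq_or_ne i' i with rfl | hi
    -- In the lowered output the unit coincides with the point of the edge, as `c' ≠ c`.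
    · have := hpos.2.2.1 i'
      rcases c' with k' | i''
      · simpa [edgePoint, pos, worse] using this
      · have hi : i' ≠ i'' := fun h => hne (by rw [h])
        simpa [edgePoint, pos, worse, hi] using this
    · simpa [edgePoint, worse, hi] using (hZ j).2.2.1 i'

lemma Smoothing.Closer.mono {s t : ℝ} {a b : Smoothing m r n} (h : a.Closer s b) (hst : s ≤ t)
    (ha : 0 ≤ a.dist) : a.Closer t b :=
  ⟨h.1, h.2.1, h.2.2.1, h.2.2.2.1, h.2.2.2.2.1,
    h.2.2.2.2.2.trans (mul_le_mul_of_nonneg_right hst ha)⟩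

lemma Smoothing.Closer.trans {s t : ℝ} {a b c : Smoothing m r n} (h : a.Closer s b)
    (h' : b.Closer t c) (ht : 0 ≤ t) : a.Closer (s * t) c := by
  obtain ⟨h1, h2, h3, h4, h5, h6⟩ := h
  obtain ⟨h1', h2', h3', h4', h5', h6'⟩ := h'
  refine ⟨h1'.trans h1, h2'.trans h2, h3'.trans h3, h4'.trans h4, h5', h6'.trans ?_⟩
  have := mul_le_mul_of_nonneg_left h6 ht
  linarith

/-- The unit `a` with its distance multiplied by `t`. -/
def Smoothing.shrink (t : ℝ) (a : Smoothing m r n) : Smoothing m r n :=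
  { a with dist := t * a.dist }

lemma Smoothing.closer_shrink {t : ℝ} (ht : 0 < t) {a : Smoothing m r n} (ha : 0 < a.dist) :
    a.Closer t (a.shrink t) :=
  ⟨rfl, rfl, rfl, rfl, mul_pos ht ha, le_rfl⟩

lemma Smoothing.IsValid.closer {Z : Fin n → Act m r} (hZ : ∀ j, IsProductionUnit (Z j))
    {a b : Smoothing m r n} (ha : a.IsValid Z) {t : ℝ} (ht : t ≤ 1) (h : a.Closer t b) :
    b.IsValid Z := by
  have hnn := ha.edgePoint_nonneg hZ
  have hd := ha.dist_pos
  have hu := isProductionUnit_iff.1 ha.isUnit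
  obtain ⟨h1, h2, h3, h4, h5, h6⟩ := h
  have hslot := ha.slot
  rw [← h1, ← h2, ← h3] at hslot
  refine ⟨hslot, h4 ▸ ha.along_pos, h5, isProductionUnit_iff.2 ?_⟩
  have hle : b.dist ≤ a.dist := h6.trans (mul_le_of_le_one_left hd.le ht)
  -- The moved unit is a convex combination of the old one and of the point on the edge.
  have hcomb : b.pos Z = (b.dist / a.dist) • a.pos Z +
      (1 - b.dist / a.dist) • a.edgePoint Z := by
    have hb : b.edgePoint Z = a.edgePoint Z := by simp [edgePoint, h1, h2, h4]
    rw [pos_eq, pos_eq, hb, h3, smul_add, smul_smul, div_mul_cancel₀ _ hd.ne', sub_smul,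
      one_smul]
    abel
  have hq : 0 ≤ 1 - b.dist / a.dist := by
    rw [sub_nonneg, div_le_one hd]
    exact hle
  rw [hcomb]
  exact ⟨add_pos_of_pos_of_nonneg (smul_pos (div_pos h5 hd) hu.1) (smul_nonneg hq hnn.1),
    add_pos_of_pos_of_nonneg (smul_pos (div_pos h5 hd) hu.2) (smul_nonneg hq hnn.2)⟩

lemma exists_rel_of_forall₂ {α β : Type*} {R : α → β → Prop} {L : List α} {L' : List β}
    (h : List.Forall₂ R L L') : (∀ b ∈ L', ∃ a ∈ L, R a b) ∧ ∀ a ∈ L, ∃ b ∈ L', R a b := by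
  induction h with
  | nil => simp
  | cons hab _ ih =>
    refine ⟨fun x hx => ?_, fun x hx => ?_⟩
    · rcases List.mem_cons.1 hx with rfl | hx
      · exact ⟨_, List.mem_cons_self, hab⟩
      · obtain ⟨y, hy, hxy⟩ := ih.1 x hx
        exact ⟨y, List.mem_cons_of_mem _ hy, hxy⟩
    · rcases List.mem_cons.1 hx with rfl | hx
      · exact ⟨_, List.mem_cons_self, hab⟩
      · obtain ⟨y, hy, hxy⟩ := ih.2 x hx
        exact ⟨y, List.mem_cons_of_mem _ hy, hxy⟩

lemma forall₂_map_right {α : Type*} {R : α → α → Prop} {f : α → α} {L : List α}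
    (h : ∀ a ∈ L, R a (f a)) : List.Forall₂ R L (L.map f) := by
  rw [List.forall₂_map_right_iff, List.forall₂_same]
  exact h

lemma forall₂_trans {α : Type*} {R S T : α → α → Prop} (h : ∀ a b c, R a b → S b c → T a c) :
    ∀ {L₁ L₂ L₃ : List α}, List.Forall₂ R L₁ L₂ → List.Forall₂ S L₂ L₃ → List.Forall₂ T L₁ L₃
  | [], _, _, .nil, .nil => .nil
  | _ :: _, _, _, .cons h₁ t₁, .cons h₂ t₂ => .cons (h _ _ _ h₁ h₂) (forall₂_trans h t₁ t₂)

lemma withSmoothings_singleton (Z : Fin n → Act m r) (a : Smoothing m r n) :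
    withSmoothings Z [a] = insert (a.pos Z) (observed Z) := by
  ext p
  simp [withSmoothings]

lemma observed_subset_withSmoothings (Z : Fin n → Act m r) (L : List (Smoothing m r n)) :
    observed Z ⊆ withSmoothings Z L := Finset.subset_union_left

/-- No efficient unit is lost once the artificial units of Part 1 are close enough. -/
lemma exists_closer_not_lost {Z : Fin n → Act m r} (hZ : ∀ j, IsProductionUnit (Z j))
    {L : List (Smoothing m r n)} (hL : ∀ a ∈ L, a.IsValid Z) :
    ∃ τ > 0, ∀ L', List.Forall₂ (Smoothing.Closer τ) L L' → ¬ Lost Z (withSmoothings Z L') := by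
  obtain ⟨ε, hε, h⟩ := exists_pos_not_lost_of_near hZ (subset_refl (observed Z)) (lt_irrefl _)
    (P := (fun a : Smoothing m r n => (a.edgePoint Z, -worse a.other)) '' {a | a ∈ L})
    (L.finite_toSet.image _) (by
      rintro _ ⟨a, ha, rfl⟩
      exact ⟨(hL a ha).edgePoint_mem, (hL a ha).not_isPareto_edgePoint⟩)
  obtain ⟨D, hD⟩ := (L.finite_toSet.image Smoothing.dist).bddAbove
  refine ⟨ε / (|D| + 1), by positivity, fun L' hL' =>
    h _ (observed_subset_withSmoothings Z L') fun t ht => ?_⟩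
  rcases Finset.mem_union.1 ht with ht | ht
  · exact .inl ht
  · simp only [List.mem_toFinset, List.mem_map] at ht
    obtain ⟨b, hb, rfl⟩ := ht
    obtain ⟨a, ha, h1, h2, h3, h4, h5, h6⟩ := (exists_rel_of_forall₂ hL').1 b hb
    refine .inr ⟨_, ⟨a, ha, rfl⟩, b.dist, h5, h6.trans ?_, ?_⟩
    · have haD : a.dist ≤ |D| + 1 := by
        have := hD ⟨a, ha, rfl⟩
        have := le_abs_self D
        linarith
      calc ε / (|D| + 1) * a.dist ≤ ε / (|D| + 1) * (|D| + 1) := by gcongr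
        _ = ε := div_mul_cancel₀ _ (by positivity)
    · rw [Smoothing.pos_eq, h3]
      simp [Smoothing.edgePoint, h1, h2, h4]

/-! ### Artificial units of Part 3 -/

/-- The direction in which an artificial unit of Part 3 is displaced. -/
def Pushing.outward (Z : Fin n → Act m r) (a : Pushing n) : Act m r :=
  match a.orient with
  | .input => (-(Z a.unit).1, 0)
  | .output => (0, (Z a.unit).2)

/-- The objective value of the artificial unit on the radial line of the unit it comes from. -/
def Pushing.score (a : Pushing n) : ℝ :=
  match a.orient with
  | .input => a.base - a.dist
  | .output => a.base + a.dist

lemma Pushing.pos_eq_radial (Z : Fin n → Act m r) (a : Pushing n) :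
    a.pos Z = radial a.orient a.score (Z a.unit) := by
  rcases a with ⟨j, _ | _, t, δ⟩ <;> rfl

lemma Pushing.pos_eq (Z : Fin n → Act m r) (a : Pushing n) :
    a.pos Z = radial a.orient a.base (Z a.unit) + a.dist • a.outward Z := by
  rcases a with ⟨j, _ | _, t, δ⟩
  · simp [pos, outward, radial, sub_eq_add_neg, add_smul]
  · simp [pos, outward, radial, add_smul]

/-- The properties of an artificial unit that is being processed in Part 3, `S` being the current
set of units. -/
structure Pushing.IsValid (Z : Fin n → Act m r) (S : Finset (Act m r)) (a : Pushing n) :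
    Prop where
  weak : ProjectsWeakly Z S a.orient a.unit a.base
  dist_pos : 0 < a.dist
  isUnit : IsProductionUnit (a.pos Z)

lemma Pushing.Closer.mono {s t : ℝ} {a b : Pushing n} (h : a.Closer s b) (hst : s ≤ t)
    (ha : 0 ≤ a.dist) : a.Closer t b :=
  ⟨h.1, h.2.1, h.2.2.1, h.2.2.2.1, h.2.2.2.2.trans (mul_le_mul_of_nonneg_right hst ha)⟩

lemma Pushing.Closer.trans {s t : ℝ} {a b c : Pushing n} (h : a.Closer s b)
    (h' : b.Closer t c) (ht : 0 ≤ t) : a.Closer (s * t) c := by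
  obtain ⟨h1, h2, h3, h4, h5⟩ := h
  obtain ⟨h1', h2', h3', h4', h5'⟩ := h'
  refine ⟨h1'.trans h1, h2'.trans h2, h3'.trans h3, h4', h5'.trans ?_⟩
  have := mul_le_mul_of_nonneg_left h5 ht
  linarith

/-- The unit `a` with its distance multiplied by `t`. -/
def Pushing.shrink (t : ℝ) (a : Pushing n) : Pushing n :=
  { a with dist := t * a.dist }

lemma Pushing.closer_shrink {t : ℝ} (ht : 0 < t) {a : Pushing n} (ha : 0 < a.dist) :
    a.Closer t (a.shrink t) :=
  ⟨rfl, rfl, rfl, mul_pos ht ha, le_rfl⟩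

lemma isProductionUnit_radial {z : Act m r} (hz : IsProductionUnit z) {t : ℝ} (ht : 0 < t)
    (o : Orientation) : IsProductionUnit (radial o t z) := by
  rw [isProductionUnit_iff] at hz ⊢
  cases o
  exacts [⟨smul_pos ht hz.1, hz.2⟩, ⟨hz.1, smul_pos ht hz.2⟩]

lemma IsScore.pos {S : Finset (Act m r)} (hS : ∀ p ∈ S, IsProductionUnit p) {z : Act m r}
    (hzS : z ∈ S) {o : Orientation} {t : ℝ} (h : IsScore o S z t) : 0 < t := by
  rw [isScore_iff] at h
  cases o
  · exact pos_of_radial_input_mem hS (hS z hzS) h.1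
  · exact zero_lt_one.trans_le (h.2 1 (by simpa using mem_pps_of_mem hzS))

lemma Pushing.IsValid.closer {Z : Fin n → Act m r} (hZ : ∀ j, IsProductionUnit (Z j))
    {S : Finset (Act m r)} (hS : ∀ p ∈ S, IsProductionUnit p) (hobs : observed Z ⊆ S)
    {a b : Pushing n} (ha : a.IsValid Z S) {t : ℝ} (ht : t ≤ 1) (h : a.Closer t b) :
    b.IsValid Z S := by
  have hbase : 0 < a.base := ha.weak.1.pos hS (hobs (mem_observed Z _))
  have hweak := ha.weak
  have hunit := ha.isUnit
  obtain ⟨h1, h2, h3, h4, h5⟩ := h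
  have hle : b.dist ≤ a.dist := h5.trans (mul_le_of_le_one_left ha.dist_pos.le ht)
  rw [← h1, ← h2, ← h3] at hweak
  refine ⟨hweak, h4, ?_⟩
  rw [pos_eq_radial]
  refine isProductionUnit_radial (hZ _) ?_ _
  rcases a with ⟨j, o, s, δ⟩
  rcases b with ⟨j', o', s', δ'⟩
  dsimp only at *
  subst h1 h2 h3
  cases o'
  · -- The inputs of the old unit are nonnegative and nonzero, so its score was positive.
    have hx : 0 < (s' - δ) • (Z j').1 := (isProductionUnit_iff.1 hunit).1
    have : 0 < s' - δ := by
      by_contra! hneg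
      exact absurd (hx.trans_le (smul_nonpos_of_nonpos_of_nonneg hneg (hZ j').1)) (lt_irrefl _)
    simp only [score]
    linarith
  · simp only [score]
    linarith

lemma withPushings_cons (Z : Fin n → Act m r) (K : Finset (Act m r)) (a : Pushing n)
    (L : List (Pushing n)) :
    withPushings Z K (a :: L) = insert (a.pos Z) (withPushings Z K L) := by
  ext p
  simp only [withPushings, List.map_cons, List.toFinset_cons, Finset.mem_union,
    Finset.mem_insert]
  tauto

lemma observed_subset_withPushings (Z : Fin n → Act m r) (K : Finset (Act m r))
    (L : List (Pushing n)) : observed Z ⊆ withPushings Z K L :=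
  Finset.subset_union_left.trans Finset.subset_union_left

lemma ProjectsWeakly.mem_pps {Z : Fin n → Act m r} {S : Finset (Act m r)} {o : Orientation}
    {j : Fin n} {t : ℝ} (h : ProjectsWeakly Z S o j t) : radial o t (Z j) ∈ pps S :=
  (isScore_iff.1 h.1).1

lemma ProjectsWeakly.not_isPareto {Z : Fin n → Act m r} (hZ : ∀ j, IsProductionUnit (Z j))
    {S : Finset (Act m r)} (hS : ∀ p ∈ S, IsProductionUnit p) (hobs : observed Z ⊆ S)
    {o : Orientation} {j : Fin n} {t : ℝ} (h : ProjectsWeakly Z S o j t) :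
    ¬ IsPareto S (radial o t (Z j)) := fun hp =>
  h.2 (hp.isEfficient
    (isProductionUnit_radial (hZ j) (h.1.pos hS (hobs (mem_observed Z j))) o))

/-- No efficient unit is lost once the artificial unit processed in Part 3 is close enough. -/
lemma Pushing.IsValid.exists_closer_not_lost {Z : Fin n → Act m r}
    (hZ : ∀ j, IsProductionUnit (Z j)) {K : Finset (Act m r)} {L : List (Pushing n)}
    (hS : ∀ p ∈ withPushings Z K L, IsProductionUnit p) (hl : ¬ Lost Z (withPushings Z K L))
    {a : Pushing n} (ha : a.IsValid Z (withPushings Z K L)) :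
    ∃ τ > 0, ∀ b, a.Closer τ b → ¬ Lost Z (withPushings Z K (b :: L)) := by
  have hobs := observed_subset_withPushings Z K L
  obtain ⟨ε, hε, h⟩ := exists_pos_not_lost_of_near hZ hobs hl
    (P := {(radial a.orient a.base (Z a.unit), a.outward Z)}) (Set.finite_singleton _) (by
      rintro _ rfl
      exact ⟨ha.weak.mem_pps, ha.weak.not_isPareto hZ hS hobs⟩)
  refine ⟨ε / a.dist, div_pos hε ha.dist_pos, fun b hb =>
    h _ (observed_subset_withPushings Z K _) fun t ht => ?_⟩
  rw [withPushings_cons, Finset.mem_insert] at ht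
  rcases ht with rfl | ht
  · obtain ⟨h1, h2, h3, h4, h5⟩ := hb
    rw [div_mul_cancel₀ _ ha.dist_pos.ne'] at h5
    refine .inr ⟨_, rfl, b.dist, h4, h5, ?_⟩
    rw [Pushing.pos_eq, h2, h3, h1]
    simp [outward, h1, h2]
  · exact .inl ht

variable {Z : Fin n → Act m r} {O : Set Orientation} {ρ : ℝ}

/-! ### The invariant of the procedure -/

/-- In every plane of Part 1, the PPS of `S` contains a point beyond the infinite edge. -/
def CoversEdges (Z : Fin n → Act m r) (S : Finset (Act m r)) : Prop :=
  ∀ j c c', IsSlot Z j c c' →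
    ∃ a δ : ℝ, 0 < δ ∧ Z j + a • worse c - δ • worse c' ∈ pps S

lemma CoversEdges.mono {S T : Finset (Act m r)} (h : CoversEdges Z S) (hST : pps S ⊆ pps T) :
    CoversEdges Z T := by
  intro j c c' hs
  obtain ⟨a, δ, hδ, hmem⟩ := h j c c' hs
  exact ⟨a, δ, hδ, hST hmem⟩

/-- What Parts 3 and 4 preserve about the current set of units. -/
structure IsStable (Z : Fin n → Act m r) (S : Finset (Act m r)) : Prop where
  units : ∀ p ∈ S, IsProductionUnit p
  covers : CoversEdges Z S
  not_lost : ¬ Lost Z S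

/-- The properties of the improved PPS spanned by the observed units and `A`. -/
def IsImproved (Z : Fin n → Act m r) (O : Set Orientation) (A : Finset (Act m r)) : Prop :=
  (∀ j, IsEfficient (observed Z) (Z j) → IsEfficient (observed Z ∪ A) (Z j)) ∧
  (∀ j, IsTerminal (observed Z) (Z j) →
    IsEfficient (observed Z ∪ A) (Z j) ∧ ¬ IsTerminal (observed Z ∪ A) (Z j)) ∧
  (∀ p ∈ observed Z ∪ A, ¬ IsEfficient (observed Z ∪ A) p →
    ∀ o ∈ O, ∃ t, IsScore o (observed Z ∪ A) p t ∧
      ∃ F : Set (Act m r), IsExposed ℝ (pps (observed Z ∪ A)) F ∧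
        (∀ q ∈ F, IsEfficient (observed Z ∪ A) q) ∧ radial o t p ∈ F)

/-- The invariant of the procedure. -/
def Invariant (Z : Fin n → Act m r) (O : Set Orientation) : State m r n → Prop
  | .part1 L cur => (∀ a ∈ L, a.IsValid Z) ∧ ∀ a ∈ cur, a.IsValid Z
  | .part2 L => (∀ a ∈ L, a.IsValid Z) ∧
      ∀ j c c', IsSlot Z j c c' → ∃ b ∈ L, b.unit = j ∧ b.dir = c ∧ b.other = c'
  | .part3 K L cur => IsStable Z (withPushings Z K L) ∧
      ∀ a ∈ cur, a.IsValid Z (withPushings Z K L)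
  | .part4 K L => IsStable Z (withPushings Z K L) ∧
      ¬ ∃ o ∈ O, ∃ j t, ProjectsWeakly Z (withPushings Z K L) o j t
  | .done A => IsImproved Z O A

lemma isProductionUnit_of_mem_withSmoothings (hZ : ∀ j, IsProductionUnit (Z j))
    {L : List (Smoothing m r n)} (hL : ∀ a ∈ L, a.IsValid Z) {p : Act m r}
    (hp : p ∈ withSmoothings Z L) : IsProductionUnit p := by
  rcases Finset.mem_union.1 hp with hp | hp
  · exact isProductionUnit_of_mem_observed hZ hp
  · simp only [List.mem_toFinset, List.mem_map] at hp
    obtain ⟨a, ha, rfl⟩ := hp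
    exact (hL a ha).isUnit

/-- The state in which Part 3 starts satisfies the invariant: deleting inefficient units neither
changes the PPS nor, therefore, the efficient units and the treated edges. -/
lemma isStable_efficientPart (hZ : ∀ j, IsProductionUnit (Z j)) {L : List (Smoothing m r n)}
    (hL : ∀ a ∈ L, a.IsValid Z)
    (hcov : ∀ j c c', IsSlot Z j c c' → ∃ b ∈ L, b.unit = j ∧ b.dir = c ∧ b.other = c')
    (hl : ¬ Lost Z (withSmoothings Z L)) :
    IsStable Z (withPushings Z
      (efficientPart (withSmoothings Z L) (L.map (Smoothing.pos Z)).toFinset) []) := by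
  set K := efficientPart (withSmoothings Z L) (L.map (Smoothing.pos Z)).toFinset with hK
  have hunits := fun p (hp : p ∈ withSmoothings Z L) =>
    isProductionUnit_of_mem_withSmoothings hZ hL hp
  have hS : withPushings Z K [] = observed Z ∪ K := by simp [withPushings]
  have heq : pps (observed Z ∪ K) = pps (withSmoothings Z L) := pps_union_efficientPart hunits
  have hsub : observed Z ∪ K ⊆ withSmoothings Z L :=
    Finset.union_subset_union subset_rfl (efficientPart_subset _ _)
  rw [hS]
  refine ⟨fun p hp => hunits p (hsub hp), fun j c c' hs => ?_, ?_⟩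
  · obtain ⟨b, hb, rfl, rfl, rfl⟩ := hcov j c c' hs
    refine ⟨b.along, b.dist, (hL b hb).dist_pos, ?_⟩
    rw [heq]
    exact mem_pps_of_mem (Finset.mem_union_right _ (by
      rw [List.mem_toFinset]
      exact List.mem_map_of_mem hb))
  · rw [not_lost_iff hZ (observed_subset_withSmoothings Z L)] at hl
    rw [not_lost_iff hZ Finset.subset_union_left]
    exact fun j hj => (isPareto_congr heq).2 (hl j hj)

/-- The invariant of Part 4 implies the asserted properties of the output. -/
lemma isImproved_of_isStable (hZ : ∀ j, IsProductionUnit (Z j)) {K : Finset (Act m r)}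
    {L : List (Pushing n)} (h : IsStable Z (withPushings Z K L))
    (hweak : ¬ ∃ o ∈ O, ∃ j t, ProjectsWeakly Z (withPushings Z K L) o j t) :
    IsImproved Z O
      (efficientPart (withPushings Z K L) (K ∪ (L.map (Pushing.pos Z)).toFinset)) := by
  set B := K ∪ (L.map (Pushing.pos Z)).toFinset with hB
  set W := withPushings Z K L with hWdef
  have hW : W = observed Z ∪ B := by rw [hWdef, hB, withPushings, Finset.union_assoc]
  set A := efficientPart W B with hA
  have heq : pps (observed Z ∪ A) = pps W := by
    rw [hA, hW]
    exact pps_union_efficientPart fun p hp => h.units p (hW ▸ hp)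
  have hobs : observed Z ⊆ W := observed_subset_withPushings Z K L
  have hsub : observed Z ∪ A ⊆ W := by
    rw [hW]
    exact Finset.union_subset_union subset_rfl (efficientPart_subset _ _)
  have hsubA : observed Z ⊆ observed Z ∪ A := Finset.subset_union_left
  have hkeep : ∀ j, IsEfficient (observed Z) (Z j) → IsEfficient (observed Z ∪ A) (Z j) :=
    fun j hj => ((isPareto_congr heq).2
      ((not_lost_iff hZ hobs).1 h.not_lost j hj.isPareto)).isEfficient (hZ j)
  refine ⟨hkeep, fun j hj => ⟨hkeep j hj.1, ?_⟩, fun p hp hne o ho => ?_⟩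
  · refine not_isTerminal_of_mem_pps (pps_mono hsubA) (hZ j) (mem_pps_of_mem (mem_observed Z j))
      fun c c' hc hne => ?_
    rw [heq]
    exact h.covers j c c' ⟨hj, hc, hne⟩
  · have hpobs : p ∈ observed Z := by
      refine (Finset.mem_union.1 hp).resolve_right fun hpA => hne ?_
      have hpe : IsEfficient W p := (mem_efficientPart.1 hpA).2
      exact ((isPareto_congr heq).2 hpe.isPareto).isEfficient (h.units p (hsub hp))
    obtain ⟨j, -, rfl⟩ := Finset.mem_image.1 hpobs
    obtain ⟨t, ht⟩ := exists_isScore (hZ j) (mem_pps_of_mem (hobs hpobs)) o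
    have hpar : IsPareto W (radial o t (Z j)) := by
      by_contra hnp
      exact hweak ⟨o, ho, j, t, ht, fun he => hnp he.isPareto⟩
    obtain ⟨F, hF, hFp, hmem⟩ := ((isPareto_congr heq).2 hpar).exists_face
    exact ⟨t, (isScore_congr heq).2 ht, F, hF, fun q hq => (hFp q hq).isEfficient
      ((hFp q hq).isProductionUnit fun p hp => h.units p (hsub hp)), hmem⟩

lemma Invariant.progress (hZ : ∀ j, IsProductionUnit (Z j)) {s s' : State m r n}
    (hs : Invariant Z O s) (h : Progress Z O s s') : Invariant Z O s' := by
  cases h with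
  | insert1 L a slot fresh along_pos dist_pos isUnit outside =>
    refine ⟨hs.1, fun b hb => ?_⟩
    obtain rfl : a = b := by simpa using hb
    exact ⟨slot, along_pos, dist_pos, isUnit⟩
  | store1 L a guard =>
    exact ⟨List.forall_mem_cons.2 ⟨hs.2 a rfl, hs.1⟩, by simp⟩
  | end1 L all => exact ⟨hs.1, all⟩
  | end2 L guard => exact ⟨isStable_efficientPart hZ hs.1 hs.2 guard, by simp⟩
  | insert3 K L a orient_mem guard dist_pos isUnit outside =>
    refine ⟨hs.1, fun b hb => ?_⟩
    obtain rfl : a = b := by simpa using hb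
    exact ⟨guard, dist_pos, isUnit⟩
  | store3 K L a guard =>
    refine ⟨⟨fun p hp => ?_, hs.1.covers.mono (pps_mono ?_), guard⟩, by simp⟩
    · rw [withPushings_cons, Finset.mem_insert] at hp
      rcases hp with rfl | hp
      exacts [(hs.2 a rfl).isUnit, hs.1.units p hp]
    · rw [withPushings_cons]
      exact Finset.subset_insert _ _
  | end3 K L guard => exact ⟨hs.1, guard⟩
  | end4 K L guard => exact isImproved_of_isStable hZ hs.1 hs.2

lemma Invariant.correction (hZ : ∀ j, IsProductionUnit (Z j)) (hρ : ρ ≤ 1) {s s' : State m r n}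
    (hs : Invariant Z O s) (h : Correction Z ρ s s') : Invariant Z O s' := by
  cases h with
  | move1 L a a' guard closer =>
    refine ⟨hs.1, fun b hb => ?_⟩
    obtain rfl : a' = b := by simpa using hb
    exact (hs.2 a rfl).closer hZ hρ closer
  | move2 L L' guard closer =>
    obtain ⟨h1, h2⟩ := exists_rel_of_forall₂ closer
    refine ⟨fun b hb => ?_, fun j c c' hslot => ?_⟩
    · obtain ⟨a, ha, hab⟩ := h1 b hb
      exact (hs.1 a ha).closer hZ hρ hab
    · obtain ⟨a, ha, rfl, rfl, rfl⟩ := hs.2 j c c' hslot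
      obtain ⟨b, hb, hab⟩ := h2 a ha
      exact ⟨b, hb, hab.1, hab.2.1, hab.2.2.1⟩
  | move3 K L a a' guard closer =>
    refine ⟨hs.1, fun b hb => ?_⟩
    obtain rfl : a' = b := by simpa using hb
    exact (hs.2 a rfl).closer hZ hs.1.units (observed_subset_withPushings Z K L) hρ closer
  | move4 K L L' guard closer => exact absurd guard hs.1.not_lost

lemma Invariant.of_reaches (hZ : ∀ j, IsProductionUnit (Z j)) (hρ : ρ ≤ 1) {s s' : State m r n}
    (hs : Invariant Z O s) (h : Reaches Z O ρ s s') : Invariant Z O s' := by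
  induction h with
  | refl => exact hs
  | tail _ hstep ih => exact hstep.elim (ih.progress hZ) (ih.correction hZ hρ)

lemma invariant_start (Z : Fin n → Act m r) (O : Set Orientation) :
    Invariant Z O (start m r n) := by
  simp [start, Invariant]

/-! ### The correction loops are finite -/

/-- An infinite run of corrections would bring the processed units arbitrarily close to the
frontier, where no efficient unit is lost. -/
lemma not_exists_infinite_correction (hZ : ∀ j, IsProductionUnit (Z j)) (hρ0 : 0 < ρ)
    (hρ1 : ρ < 1) {s : State m r n} (hs : Invariant Z O s) :
    ¬ ∃ f : ℕ → State m r n, f 0 = s ∧ ∀ k, Correction Z ρ (f k) (f (k + 1)) := by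
  rintro ⟨f, rfl, hf⟩
  have h0 := hf 0
  generalize hs0 : f 0 = s at hs h0
  generalize f (0 + 1) = s' at h0
  cases h0 with
  | move1 L a a' guard closer =>
    have ha := hs.2 a rfl
    have hrun : ∀ k, ∃ b, f k = .part1 L (some b) ∧ a.Closer (ρ ^ k) b := by
      intro k
      induction k with
      | zero => exact ⟨a, hs0, rfl, rfl, rfl, rfl, ha.dist_pos, by simp⟩
      | succ k ih =>
        obtain ⟨b, hb, hab⟩ := ih
        have h := hf k
        rw [hb] at h
        generalize hs' : f (k + 1) = s' at h
        cases h with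
        | move1 _ _ b' _ hbb' => exact ⟨b', rfl, hab.trans hbb' hρ0.le⟩
    obtain ⟨τ, hτ, hτl⟩ := exists_closer_not_lost hZ (L := [a]) (by simpa using ha)
    obtain ⟨k, hk⟩ := exists_pow_lt_of_lt_one hτ hρ1
    obtain ⟨b, hb, hab⟩ := hrun k
    have h := hf k
    rw [hb] at h
    generalize f (k + 1) = s' at h
    cases h with
    | move1 _ _ b' hl _ =>
      rw [← withSmoothings_singleton] at hl
      exact hτl [b] (.cons (hab.mono hk.le ha.dist_pos.le) .nil) hl
  | move2 L L' guard closer =>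
    have hrun : ∀ k, ∃ L', f k = .part2 L' ∧ List.Forall₂ (Smoothing.Closer (ρ ^ k)) L L' := by
      intro k
      induction k with
      | zero =>
        refine ⟨L, hs0, List.forall₂_same.2 fun a ha => ?_⟩
        exact ⟨rfl, rfl, rfl, rfl, (hs.1 a ha).dist_pos, by simp⟩
      | succ k ih =>
        obtain ⟨L₁, hL₁, hLL₁⟩ := ih
        have h := hf k
        rw [hL₁] at h
        generalize hs' : f (k + 1) = s' at h
        cases h with
        | move2 _ L₂ _ hLL₂ =>
          exact ⟨L₂, rfl, forall₂_trans (fun _ _ _ h h' => h.trans h' hρ0.le) hLL₁ hLL₂⟩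
    obtain ⟨τ, hτ, hτl⟩ := exists_closer_not_lost hZ hs.1
    obtain ⟨k, hk⟩ := exists_pow_lt_of_lt_one hτ hρ1
    obtain ⟨L₁, hL₁, hLL₁⟩ := hrun k
    have h := hf k
    rw [hL₁] at h
    generalize f (k + 1) = s' at h
    cases h with
    | move2 _ _ hl _ =>
      have hsame : List.Forall₂ (fun a b => a ∈ L ∧ a = b) L L :=
        List.forall₂_same.2 fun a ha => ⟨ha, rfl⟩
      exact hτl L₁ (forall₂_trans (fun a b c hab hbc => by
        obtain ⟨ha, rfl⟩ := hab
        exact hbc.mono hk.le (hs.1 a ha).dist_pos.le) hsame hLL₁) hl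
  | move3 K L a a' guard closer =>
    have ha := hs.2 a rfl
    have hrun : ∀ k, ∃ b, f k = .part3 K L (some b) ∧ a.Closer (ρ ^ k) b := by
      intro k
      induction k with
      | zero => exact ⟨a, hs0, rfl, rfl, rfl, ha.dist_pos, by simp⟩
      | succ k ih =>
        obtain ⟨b, hb, hab⟩ := ih
        have h := hf k
        rw [hb] at h
        generalize hs' : f (k + 1) = s' at h
        cases h with
        | move3 _ _ _ b' _ hbb' => exact ⟨b', rfl, hab.trans hbb' hρ0.le⟩
    obtain ⟨τ, hτ, hτl⟩ := ha.exists_closer_not_lost hZ hs.1.units hs.1.not_lost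
    obtain ⟨k, hk⟩ := exists_pow_lt_of_lt_one hτ hρ1
    obtain ⟨b, hb, hab⟩ := hrun k
    have h := hf k
    rw [hb] at h
    generalize f (k + 1) = s' at h
    cases h with
    | move3 _ _ _ b' hl _ => exact hτl b (hab.mono hk.le ha.dist_pos.le) hl
  | move4 K L L' guard closer => exact hs.1.not_lost guard

/-! ### The procedure can be brought to an end -/

lemma Progress.reaches {s s' : State m r n} (h : Progress Z O s s') : Reaches Z O ρ s s' :=
  .single (.inl h)

lemma Correction.reaches {s s' : State m r n} (h : Correction Z ρ s s') : Reaches Z O ρ s s' :=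
  .single (.inr h)

/-- The unit processed in Part 1 can be stored after at most one move. -/
lemma exists_reaches_store1 (hZ : ∀ j, IsProductionUnit (Z j)) (hρ0 : 0 < ρ)
    {L : List (Smoothing m r n)} {a : Smoothing m r n} (ha : a.IsValid Z) :
    ∃ b : Smoothing m r n, (b.unit = a.unit ∧ b.dir = a.dir ∧ b.other = a.other) ∧
      Reaches Z O ρ (.part1 L (some a)) (.part1 (b :: L) none) := by
  by_cases hl : Lost Z (insert (a.pos Z) (observed Z))
  · obtain ⟨τ, hτ, h⟩ := exists_closer_not_lost hZ (L := [a]) (by simpa using ha)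
    have hcl := Smoothing.closer_shrink (lt_min hρ0 hτ) ha.dist_pos
    refine ⟨a.shrink (min ρ τ), ⟨rfl, rfl, rfl⟩,
      (Correction.move1 L a _ hl (hcl.mono (min_le_left _ _) ha.dist_pos.le)).reaches.trans
        (Progress.store1 L _ ?_).reaches⟩
    rw [← withSmoothings_singleton]
    exact h _ (.cons (hcl.mono (min_le_right _ _) ha.dist_pos.le) .nil)
  · exact ⟨a, ⟨rfl, rfl, rfl⟩, (Progress.store1 L a hl).reaches⟩

/-- If all data are positive, Part 1 can insert a unit in every plane that it has to treat. -/
lemma exists_smoothing (hZ : ∀ j, IsProductionUnit (Z j))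
    (hpos : ∀ j, (∀ k, 0 < (Z j).1 k) ∧ ∀ i, 0 < (Z j).2 i) {j : Fin n} {c c' : Fin m ⊕ Fin r}
    (hslot : IsSlot Z j c c') :
    ∃ a : Smoothing m r n, (a.unit = j ∧ a.dir = c ∧ a.other = c') ∧ a.IsValid Z ∧
      a.pos Z ∉ pps (observed Z) := by
  have hev : ∀ᶠ ε in nhdsWithin (0 : ℝ) (Set.Ioi 0),
      (∀ k, 0 < (Z j + ε • worse c - ε • worse c').1 k) ∧
      ∀ i, 0 < (Z j + ε • worse c - ε • worse c').2 i := by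
    refine Filter.Eventually.filter_mono nhdsWithin_le_nhds ?_
    have hcont : Continuous fun ε : ℝ => Z j + ε • worse c - ε • worse c' := by fun_prop
    refine (Filter.eventually_all.2 fun k => ?_).and (Filter.eventually_all.2 fun i => ?_)
    · have h1 : Continuous fun ε : ℝ => (Z j + ε • worse c - ε • worse c').1 k :=
        (continuous_apply k).comp (continuous_fst.comp hcont)
      exact (h1.tendsto' 0 ((Z j).1 k) (by simp)).eventually_const_lt ((hpos j).1 k)
    · have h1 : Continuous fun ε : ℝ => (Z j + ε • worse c - ε • worse c').2 i :=
        (continuous_apply i).comp (continuous_snd.comp hcont)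
      exact (h1.tendsto' 0 ((Z j).2 i) (by simp)).eventually_const_lt ((hpos j).2 i)
  have hgt : ∀ᶠ ε in nhdsWithin (0 : ℝ) (Set.Ioi 0), 0 < ε := eventually_mem_nhdsWithin
  obtain ⟨ε, ⟨hx, hy⟩, hε⟩ := (hev.and hgt).exists
  obtain ⟨k, -⟩ := (Pi.lt_def.1 (isProductionUnit_iff.1 (hZ j)).1).2
  obtain ⟨i, -⟩ := (Pi.lt_def.1 (isProductionUnit_iff.1 (hZ j)).2).2
  refine ⟨⟨j, c, c', ε, ε⟩, ⟨rfl, rfl, rfl⟩, ⟨hslot, hε, hε, isProductionUnit_iff.2 ⟨?_, ?_⟩⟩,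
    notMem_pps_of_isExposed_ray hslot.2.1 hslot.2.2 ε hε⟩
  · exact Pi.lt_def.2 ⟨fun k => (hx k).le, k, hx k⟩
  · exact Pi.lt_def.2 ⟨fun i => (hy i).le, i, hy i⟩

/-- The planes that Part 1 still has to treat. -/
def openSlots (Z : Fin n → Act m r) (L : List (Smoothing m r n)) :
    Set (Fin n × (Fin m ⊕ Fin r) × (Fin m ⊕ Fin r)) :=
  {x | IsSlot Z x.1 x.2.1 x.2.2 ∧
    ∀ b ∈ L, ¬ (b.unit = x.1 ∧ b.dir = x.2.1 ∧ b.other = x.2.2)}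

lemma exists_reaches_part2 (hZ : ∀ j, IsProductionUnit (Z j))
    (hpos : ∀ j, (∀ k, 0 < (Z j).1 k) ∧ ∀ i, 0 < (Z j).2 i) (hρ0 : 0 < ρ)
    (L : List (Smoothing m r n)) :
    ∃ L', Reaches Z O ρ (.part1 L none) (.part2 L') := by
  induction hN : (openSlots Z L).ncard using Nat.strong_induction_on generalizing L with
  | _ N ih =>
    rcases (openSlots Z L).eq_empty_or_nonempty with hemp | ⟨⟨j, c, c'⟩, hslot, hfresh⟩
    · refine ⟨L, (Progress.end1 L fun j c c' hs => ?_).reaches⟩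
      by_contra! hno
      have : (j, c, c') ∈ openSlots Z L := ⟨hs, fun b hb hbb => hno b hb hbb.1 hbb.2.1 hbb.2.2⟩
      rw [hemp] at this
      exact this
    · obtain ⟨a, ⟨rfl, rfl, rfl⟩, ha, hout⟩ := exists_smoothing hZ hpos hslot
      obtain ⟨b, ⟨hb1, hb2, hb3⟩, hreach⟩ :=
        exists_reaches_store1 (O := O) (L := L) hZ hρ0 ha
      have hlt : (openSlots Z (b :: L)).ncard < N := by
        rw [← hN]
        refine Set.ncard_lt_ncard ⟨fun x hx => ⟨hx.1, fun b' hb' =>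
          hx.2 b' (List.mem_cons_of_mem _ hb')⟩, fun hsub => ?_⟩
        exact (hsub (a := (a.unit, a.dir, a.other)) ⟨hslot, hfresh⟩).2 b List.mem_cons_self
          ⟨hb1, hb2, hb3⟩
      obtain ⟨L', hL'⟩ := ih _ hlt (b :: L) rfl
      exact ⟨L', ((Progress.insert1 L a ha.slot hfresh ha.along_pos ha.dist_pos ha.isUnit
        hout).reaches.trans hreach).trans hL'⟩

lemma exists_reaches_part3 (hZ : ∀ j, IsProductionUnit (Z j)) (hρ0 : 0 < ρ)
    {L : List (Smoothing m r n)} (hL : ∀ a ∈ L, a.IsValid Z) :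
    ∃ K, Reaches Z O ρ (.part2 L) (.part3 K [] none) := by
  by_cases hl : Lost Z (withSmoothings Z L)
  · obtain ⟨τ, hτ, h⟩ := exists_closer_not_lost hZ hL
    have hcl := fun a (ha : a ∈ L) => Smoothing.closer_shrink (lt_min hρ0 hτ) (hL a ha).dist_pos
    refine ⟨_, (Correction.move2 L (L.map (Smoothing.shrink (min ρ τ))) hl ?_).reaches.trans
      (Progress.end2 _ (h _ ?_)).reaches⟩
    · exact forall₂_map_right fun a ha =>
        (hcl a ha).mono (min_le_left _ _) (hL a ha).dist_pos.le
    · exact forall₂_map_right fun a ha =>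
        (hcl a ha).mono (min_le_right _ _) (hL a ha).dist_pos.le
  · exact ⟨_, (Progress.end2 L hl).reaches⟩

/-- The unit processed in Part 3 can be stored after at most one move. -/
lemma exists_reaches_store3 (hZ : ∀ j, IsProductionUnit (Z j)) (hρ0 : 0 < ρ)
    {K : Finset (Act m r)} {L : List (Pushing n)} (hS : IsStable Z (withPushings Z K L))
    {a : Pushing n} (ha : a.IsValid Z (withPushings Z K L)) :
    ∃ b, Reaches Z O ρ (.part3 K L (some a)) (.part3 K (b :: L) none) := by
  by_cases hl : Lost Z (withPushings Z K (a :: L))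
  · obtain ⟨τ, hτ, h⟩ := ha.exists_closer_not_lost hZ hS.units hS.not_lost
    have hcl := Pushing.closer_shrink (lt_min hρ0 hτ) ha.dist_pos
    exact ⟨a.shrink (min ρ τ),
      (Correction.move3 K L a _ hl (hcl.mono (min_le_left _ _) ha.dist_pos.le)).reaches.trans
        (Progress.store3 K L _ (h _ (hcl.mono (min_le_right _ _) ha.dist_pos.le))).reaches⟩
  · exact ⟨a, (Progress.store3 K L a hl).reaches⟩

/-- The orientations and observed units that Part 3 still has to treat. -/
def weakPairs (Z : Fin n → Act m r) (O : Set Orientation) (S : Finset (Act m r)) :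
    Set (Orientation × Fin n) :=
  {x | x.1 ∈ O ∧ ∃ t, ProjectsWeakly Z S x.1 x.2 t}

lemma finite_orientation : Finite Orientation :=
  Finite.of_injective (fun o : Orientation => match o with | .input => true | .output => false)
    (by rintro (_ | _) (_ | _) h <;> simp_all)

/-- In Part 3, a unit can be inserted so close to the frontier that no pair is added to those still
to be treated, as all efficient projections stay efficient. The pair it is inserted for drops
out, as the inserted unit becomes its projection and is efficient. -/
lemma exists_pushing (hZ : ∀ j, IsProductionUnit (Z j)) {K : Finset (Act m r)}
    {L : List (Pushing n)} (hS : IsStable Z (withPushings Z K L)) {o : Orientation} {j : Fin n}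
    (hoj : (o, j) ∈ weakPairs Z O (withPushings Z K L)) :
    ∃ a, Progress Z O (.part3 K L none) (.part3 K L (some a)) ∧
      ¬ Lost Z (withPushings Z K (a :: L)) ∧
      weakPairs Z O (withPushings Z K (a :: L)) ⊂ weakPairs Z O (withPushings Z K L) := by
  have := finite_orientation
  obtain ⟨ho, t, hw⟩ := hoj
  dsimp only at ho hw
  have hobs := observed_subset_withPushings Z K L
  set W := withPushings Z K L with hW
  have hscore : ∀ x : Orientation × Fin n, ∃ s, IsScore x.1 W (Z x.2) s := fun x =>
    exists_isScore (hZ x.2) (mem_pps_of_mem (hobs (mem_observed Z x.2))) x.1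
  choose σ hσ using hscore
  have ht : 0 < t := hw.1.pos hS.units (hobs (mem_observed Z j))
  obtain ⟨ε, hε, hnear⟩ := exists_pos_isPareto_of_near (S := W)
    (Q := {q | IsPareto W q ∧ q ∈ Set.range Z ∪
      Set.range fun x : Orientation × Fin n => radial x.1 (σ x) (Z x.2)})
    (((Set.finite_range _).union (Set.finite_range _)).subset fun q hq => hq.2)
    (fun q hq => hq.1)
    (P := {(radial o t (Z j), (⟨j, o, t, 0⟩ : Pushing n).outward Z)}) (Set.finite_singleton _)
    (by
      rintro _ rfl
      exact ⟨hw.mem_pps, hw.not_isPareto hZ hS.units hobs⟩)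
  -- Half the score bounds the distance, so that the new score stays positive.
  set a : Pushing n := ⟨j, o, t, min ε (t / 2)⟩ with ha
  have hd : 0 < a.dist := lt_min hε (half_pos ht)
  have hapos : 0 < a.score := by
    have hle : a.dist ≤ t / 2 := min_le_right _ _
    cases o
    · change 0 < t - a.dist
      linarith
    · change 0 < t + a.dist
      linarith
  have hunit : IsProductionUnit (a.pos Z) := by
    rw [Pushing.pos_eq_radial]
    exact isProductionUnit_radial (hZ j) hapos _
  have hout : a.pos Z ∉ pps W := by
    rw [Pushing.pos_eq_radial]
    intro hmem
    have h := (isScore_iff.1 hw.1).2 _ hmem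
    cases o
    · change t ≤ t - a.dist at h
      linarith
    · change t + a.dist ≤ t at h
      linarith
  have hpar : ∀ q, IsPareto W q → q ∈ Set.range Z ∪
      (Set.range fun x : Orientation × Fin n => radial x.1 (σ x) (Z x.2)) →
      IsPareto (withPushings Z K (a :: L)) q := by
    intro q hq hqr
    rw [withPushings_cons]
    refine hnear _ (fun p hp => ?_) q ⟨hq, hqr⟩ (pps_mono (Finset.subset_insert _ _) hq.1)
    rcases Finset.mem_insert.1 hp with rfl | hp
    · exact .inr ⟨_, rfl, a.dist, hd, min_le_left _ _, a.pos_eq Z⟩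
    · exact .inl hp
  have hunits : ∀ p ∈ withPushings Z K (a :: L), IsProductionUnit p := by
    intro p hp
    rw [withPushings_cons, Finset.mem_insert] at hp
    rcases hp with rfl | hp
    exacts [hunit, hS.units p hp]
  have hstrong : ∀ {o' : Orientation} {j' : Fin n} {s s' : ℝ},
      IsPareto (withPushings Z K (a :: L)) (radial o' s' (Z j')) →
      ¬ ProjectsWeakly Z (withPushings Z K (a :: L)) o' j' s := by
    intro o' j' s s' hp hs
    refine hs.2 ?_
    rw [hp.radial_score_eq (hZ j') hs.1]
    exact hp.isEfficient (hp.isProductionUnit hunits)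
  refine ⟨a, .insert3 K L a ho hw hd hunit hout, ?_, fun x hx => ⟨hx.1, ?_⟩, fun hsub => ?_⟩
  · rw [not_lost_iff hZ (observed_subset_withPushings Z K _)]
    exact fun i hi => hpar _ ((not_lost_iff hZ hobs).1 hS.not_lost i hi) (.inl ⟨i, rfl⟩)
  · by_contra hno
    obtain ⟨s, hs⟩ := hx.2
    refine hstrong (hpar (radial x.1 (σ x) (Z x.2)) ?_ (.inr ⟨x, rfl⟩)) hs
    by_contra hnp
    exact hno ⟨σ x, hσ x, fun he => hnp he.isPareto⟩
  · obtain ⟨-, s, hs⟩ := hsub (a := (o, j)) ⟨ho, t, hw⟩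
    refine hstrong (s' := a.score) ?_ hs
    have := isPareto_insert_of_notMem hout
    rwa [← withPushings_cons, Pushing.pos_eq_radial] at this

lemma exists_reaches_done_of_part4 {K : Finset (Act m r)} {L : List (Pushing n)}
    (hS : IsStable Z (withPushings Z K L)) : ∃ A, Reaches Z O ρ (.part4 K L) (.done A) :=
  ⟨_, (Progress.end4 K L hS.not_lost).reaches⟩

lemma exists_reaches_done_of_part3 (hZ : ∀ j, IsProductionUnit (Z j)) {K : Finset (Act m r)}
    {L : List (Pushing n)} (hS : IsStable Z (withPushings Z K L)) :
    ∃ A, Reaches Z O ρ (.part3 K L none) (.done A) := by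
  have := finite_orientation
  induction hN : (weakPairs Z O (withPushings Z K L)).ncard using Nat.strong_induction_on
    generalizing L with
  | _ N ih =>
    rcases (weakPairs Z O (withPushings Z K L)).eq_empty_or_nonempty with hemp | ⟨⟨o, j⟩, hoj⟩
    · obtain ⟨A, hA⟩ := exists_reaches_done_of_part4 (O := O) (ρ := ρ) hS
      refine ⟨A, (Progress.end3 K L ?_).reaches.trans hA⟩
      rintro ⟨o, ho, j, t, ht⟩
      have : (o, j) ∈ weakPairs Z O (withPushings Z K L) := ⟨ho, t, ht⟩
      rw [hemp] at this
      exact this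
    · obtain ⟨a, hins, hl, hlt⟩ := exists_pushing hZ hS hoj
      have hstore := Progress.store3 (O := O) K L a hl
      have hinv : Invariant Z O (.part3 K L none) := ⟨hS, by simp⟩
      obtain ⟨A, hA⟩ := ih _ (hN ▸ Set.ncard_lt_ncard hlt)
        ((hinv.progress hZ hins).progress hZ hstore).1 rfl
      exact ⟨A, (hins.reaches.trans hstore.reaches).trans hA⟩

lemma exists_reaches_done (hZ : ∀ j, IsProductionUnit (Z j))
    (hpos : ∀ j, (∀ k, 0 < (Z j).1 k) ∧ ∀ i, 0 < (Z j).2 i) (hρ0 : 0 < ρ) (hρ1 : ρ < 1)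
    {s : State m r n} (hs : Invariant Z O s) : ∃ A, Reaches Z O ρ s (.done A) := by
  have h2 : ∀ L, Invariant Z O (.part2 L) → ∃ A, Reaches Z O ρ (.part2 L) (.done A) := by
    intro L hL
    obtain ⟨K, hK⟩ := exists_reaches_part3 (O := O) hZ hρ0 hL.1
    obtain ⟨A, hA⟩ := exists_reaches_done_of_part3 hZ (hL.of_reaches hZ hρ1.le hK).1
    exact ⟨A, hK.trans hA⟩
  have h1 : ∀ L, Invariant Z O (.part1 L none) →
      ∃ A, Reaches Z O ρ (.part1 L none) (.done A) := by
    intro L hL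
    obtain ⟨L', hL'⟩ := exists_reaches_part2 (O := O) hZ hpos hρ0 L
    obtain ⟨A, hA⟩ := h2 L' (hL.of_reaches hZ hρ1.le hL')
    exact ⟨A, hL'.trans hA⟩
  match s, hs with
  | .part1 L none, hs => exact h1 L hs
  | .part1 L (some a), hs =>
    obtain ⟨b, -, hb⟩ := exists_reaches_store1 (O := O) (L := L) hZ hρ0 (hs.2 a rfl)
    obtain ⟨A, hA⟩ := h1 _ (hs.of_reaches hZ hρ1.le hb)
    exact ⟨A, hb.trans hA⟩
  | .part2 L, hs => exact h2 L hs
  | .part3 K L none, hs => exact exists_reaches_done_of_part3 hZ hs.1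
  | .part3 K L (some a), hs =>
    obtain ⟨b, hb⟩ := exists_reaches_store3 (O := O) hZ hρ0 hs.1 (hs.2 a rfl)
    obtain ⟨A, hA⟩ := exists_reaches_done_of_part3 hZ (hs.of_reaches hZ hρ1.le hb).1
    exact ⟨A, hb.trans hA⟩
  | .part4 K L, hs => exact exists_reaches_done_of_part4 hs.1
  | .done A, _ => exact ⟨A, .refl⟩

end DEA

theorem mainTheorem1 (m r n : ℕ) (Z : Fin n → DEA.Act m r)
    (hZ : ∀ j, DEA.IsProductionUnit (Z j))
    (O : Set DEA.Orientation) (ρ : ℝ) (hρ0 : 0 < ρ) (hρ1 : ρ < 1) :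
    (∀ A : Finset (DEA.Act m r), DEA.Reaches Z O ρ (DEA.start m r n) (.done A) →
      (∀ j, DEA.IsEfficient (DEA.observed Z) (Z j) →
        DEA.IsEfficient (DEA.observed Z ∪ A) (Z j)) ∧
      (∀ j, DEA.IsTerminal (DEA.observed Z) (Z j) →
        DEA.IsEfficient (DEA.observed Z ∪ A) (Z j) ∧
          ¬ DEA.IsTerminal (DEA.observed Z ∪ A) (Z j)) ∧
      (∀ p ∈ DEA.observed Z ∪ A, ¬ DEA.IsEfficient (DEA.observed Z ∪ A) p →
        ∀ o ∈ O, ∃ t, DEA.IsScore o (DEA.observed Z ∪ A) p t ∧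
          ∃ F : Set (DEA.Act m r), IsExposed ℝ (DEA.pps (DEA.observed Z ∪ A)) F ∧
            (∀ q ∈ F, DEA.IsEfficient (DEA.observed Z ∪ A) q) ∧ DEA.radial o t p ∈ F)) ∧
    (∀ s, DEA.Reaches Z O ρ (DEA.start m r n) s →
      ¬ ∃ f : ℕ → DEA.State m r n, f 0 = s ∧ ∀ k, DEA.Correction Z ρ (f k) (f (k + 1))) ∧
    ((∀ j, (∀ k, 0 < (Z j).1 k) ∧ (∀ i, 0 < (Z j).2 i)) →
      ∀ s, DEA.Reaches Z O ρ (DEA.start m r n) s →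
        ∃ A, DEA.Reaches Z O ρ s (.done A)) := by
  have hinv : ∀ s, DEA.Reaches Z O ρ (DEA.start m r n) s → DEA.Invariant Z O s := fun s hs =>
    (DEA.invariant_start Z O).of_reaches hZ hρ1.le hs
  exact ⟨fun A hA => hinv _ hA,
    fun s hs => DEA.not_exists_infinite_correction hZ hρ0 hρ1 (hinv s hs),
    fun hpos s hs => DEA.exists_reaches_done hZ hpos hρ0 hρ1 (hinv s hs)⟩
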